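/- Let $k\ge 1$, and write $[a,b]=aba^{-1}b^{-1}$. Let $G_k$ be the group with generators $p_1,\dots,p_k,\,y_1,\dots,y_{k-1}$ and relations $$[y_i,y_j]=1;\qquad [p_i,y_j]=1\ \ (j\ge i);\qquad [p_i,\;y_jp_jp_{j+1}^{-1}]=1\ \ (j<i),$$ the indices running over all those for which $p_i$, $y_i$, $y_j$ are generators. Put $y_k=1$, $p_{k+1}=1$ and $x_i=p_ip_{i+1}^{-1}$ for $1\le i\le k$. Let $K_k$ be the group with generators $p_1,\dots,p_{k-1},y_1,\dots,y_{k-1}$ and those of the above relations in which $p_k$ does not occur. Let $$A_k=\langle y_1x_1,\dots,y_{k-2}x_{k-2},\,y_{k-1}p_{k-1}\rangle,$$ $$L_k=\langle y_1x_1y_1,\dots,y_{k-2}x_{k-2}y_{k-2},\,y_{k-1}p_{k-1}y_{k-1}\rangle,$$ $$H_k=\langle y_1x_1y_1,\dots,y_kx_ky_k\rangle,$$ where $A_1=L_1=1$. The subgroups $A_k$ and $L_k$ may be formed in $K_k$ or in $G_k$. Then: 1. $L_k\cap A_k=1$ (in $K_k$ as well as in $G_k$); 2. $H_k\subset G_k$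 is free of rank $k$; 3. $H_k\cap\langle A_k,p_k\rangle=\langle p_k\rangle$ in $G_k$. The same three statements hold in the pure braid group $P_{k+1}$ for the subgroups $A_k,L_k,H_k$ given by the same formulas, where now $x_i=A_{i,k+1}$ and $p_i=x_ix_{i+1}\cdots x_k$ for $1\le i\le k$, $y_i=A_{i,i+1}A_{i,i+2}\cdots A_{i,k}$ for $1\le i\le k-1$, and $y_k=1$. Here $P_n$ is the kernel of the homomorphism from the Artin braid group $B_n$ (generators $\sigma_1,\dots,\sigma_{n-1}$) to the symmetric group sending $\sigma_i$ to $(i\;\,i{+}1)$, and $A_{i,j}=\sigma_{j-1}\cdots\sigma_{i+1}\,\sigma_i^2\,\sigma_{i+1}^{-1}\cdots\sigma_{j-1}^{-1}$ for $1\le i<j\le n$. -/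

import Mathlib

/-! ### The subgroups `A_k`, `L_k`, `H_k` spelled by sequences of elements `x`, `p`, `y` -/

section Subgroups

/-- `A_k = ⟨y_1 x_1, …, y_{k-2} x_{k-2}, y_{k-1} p_{k-1}⟩`; no generators for `k = 1`. -/
def subA {Γ : Type*} [Group Γ] (x p y : ℕ → Γ) (k : ℕ) : Subgroup Γ :=
  Subgroup.closure
    ({g | ∃ i, 1 ≤ i ∧ i + 1 < k ∧ g = y i * x i} ∪
     {g | ∃ i, 1 ≤ i ∧ i + 1 = k ∧ g = y i * p i})

/-- `L_k = ⟨y_1 x_1 y_1, …, y_{k-2} x_{k-2} y_{k-2}, y_{k-1} p_{k-1} y_{k-1}⟩`;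
no generators for `k = 1`. -/
def subL {Γ : Type*} [Group Γ] (x p y : ℕ → Γ) (k : ℕ) : Subgroup Γ :=
  Subgroup.closure
    ({g | ∃ i, 1 ≤ i ∧ i + 1 < k ∧ g = y i * x i * y i} ∪
     {g | ∃ i, 1 ≤ i ∧ i + 1 = k ∧ g = y i * p i * y i})

/-- `H_k = ⟨y_1 x_1 y_1, …, y_k x_k y_k⟩`. -/
def subH {Γ : Type*} [Group Γ] (x y : ℕ → Γ) (k : ℕ) : Subgroup Γ :=
  Subgroup.closure {g | ∃ i, 1 ≤ i ∧ i ≤ k ∧ g = y i * x i * y i}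

end Subgroups

/-! ### The presented groups `G_k` and `K_k` -/

namespace PG

open scoped commutatorElement

/-- Generators `p_1, …, p_r` (left) and `y_1, …, y_s` (right). -/
abbrev Gens (r s : ℕ) : Type := (Set.Icc 1 r) ⊕ (Set.Icc 1 s)

/-- The letter `p_i` for `1 ≤ i ≤ r`, and `1` for other indices. -/
def wp (r s i : ℕ) : FreeGroup (Gens r s) :=
  if h : 1 ≤ i ∧ i ≤ r then FreeGroup.of (Sum.inl ⟨i, h⟩) else 1

/-- The letter `y_j` for `1 ≤ j ≤ s`, and `1` for other indices. -/
def wy (r s j : ℕ) : FreeGroup (Gens r s) :=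
  if h : 1 ≤ j ∧ j ≤ s then FreeGroup.of (Sum.inr ⟨j, h⟩) else 1

/-- The relators `[y_i, y_j]`; `[p_i, y_j]` for `j ≥ i`; `[p_i, y_j p_j p_{j+1}⁻¹]` for `j < i`,
with indices running over the generators `p_1, …, p_r`, `y_1, …, y_s`. -/
def rels (r s : ℕ) : Set (FreeGroup (Gens r s)) :=
  {w | ∃ i ∈ Set.Icc 1 s, ∃ j ∈ Set.Icc 1 s, w = ⁅wy r s i, wy r s j⁆} ∪
  {w | ∃ i ∈ Set.Icc 1 r, ∃ j ∈ Set.Icc 1 s, i ≤ j ∧ w = ⁅wp r s i, wy r s j⁆} ∪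
  {w | ∃ i ∈ Set.Icc 1 r, ∃ j ∈ Set.Icc 1 s, j < i ∧
    w = ⁅wp r s i, wy r s j * wp r s j * (wp r s (j + 1))⁻¹⁆}

/-- The group `⟨p_1, …, p_r, y_1, …, y_s | rels⟩`. -/
abbrev Grp (r s : ℕ) : Type := PresentedGroup (rels r s)

/-- `p_i` in the presented group, with the convention `p_i = 1` for `i > r`. -/
def p (r s i : ℕ) : Grp r s := PresentedGroup.mk (rels r s) (wp r s i)

/-- `y_j` in the presented group, with the convention `y_j = 1` for `j > s`. -/
def y (r s j : ℕ) : Grp r s := PresentedGroup.mk (rels r s) (wy r s j)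

/-- `x_i = p_i p_{i+1}⁻¹`. -/
def x (r s i : ℕ) : Grp r s := p r s i * (p r s (i + 1))⁻¹

end PG

/-- `G_k = ⟨p_1, …, p_k, y_1, …, y_{k-1} | …⟩`. -/
abbrev GGrp (k : ℕ) : Type := PG.Grp k (k - 1)

/-- `K_k = ⟨p_1, …, p_{k-1}, y_1, …, y_{k-1} | …⟩`. -/
abbrev KGrp (k : ℕ) : Type := PG.Grp (k - 1) (k - 1)

/-! ### Braid groups and pure braid groups -/

namespace Braid

/-- Artin's relators on `σ_1, …, σ_{n-1}`. -/
def rels (n : ℕ) : Set (FreeGroup (Set.Ico 1 n)) :=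
  {w | ∃ i j : Set.Ico 1 n, (i : ℕ) + 1 < j ∧
    w = (FreeGroup.of i * FreeGroup.of j) * (FreeGroup.of j * FreeGroup.of i)⁻¹} ∪
  {w | ∃ i j : Set.Ico 1 n, (i : ℕ) + 1 = j ∧
    w = (FreeGroup.of i * FreeGroup.of j * FreeGroup.of i) *
      (FreeGroup.of j * FreeGroup.of i * FreeGroup.of j)⁻¹}

/-- The Artin braid group `B_n` on `n` strands. -/
abbrev B (n : ℕ) : Type := PresentedGroup (rels n)

/-- `σ_i` for `1 ≤ i ≤ n - 1`, and `1` for other indices. -/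
def sigma (n i : ℕ) : B n :=
  if h : 1 ≤ i ∧ i < n then PresentedGroup.of ⟨i, h⟩ else 1

/-- The transposition `(i, i+1)` of the strands `1, …, n`. -/
def adjSwap (n : ℕ) (i : Set.Ico 1 n) : Equiv.Perm (Set.Icc 1 n) :=
  Equiv.swap ⟨i, i.2.1, i.2.2.le⟩ ⟨i + 1, Nat.le_add_left 1 i, i.2.2⟩

theorem adjSwap_rels (n : ℕ) : ∀ w ∈ rels n, FreeGroup.lift (adjSwap n) w = 1 := by
  rintro w (⟨⟨i, hi⟩, ⟨j, hj⟩, hij, rfl⟩ | ⟨⟨i, hi⟩, ⟨j, hj⟩, hij, rfl⟩)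
  · simp only at hij
    rw [map_mul, map_inv, mul_inv_eq_one, map_mul, map_mul, FreeGroup.lift_apply_of,
      FreeGroup.lift_apply_of]
    refine (Equiv.Perm.disjoint_swap_swap ?_).commute.eq
    simp only [List.nodup_cons, List.mem_cons, List.not_mem_nil, or_false, not_or,
      Subtype.ext_iff, List.nodup_nil, not_false_eq_true, and_true]
    omega
  · simp only at hij
    subst hij
    rw [map_mul, map_inv, mul_inv_eq_one]
    simp only [map_mul, FreeGroup.lift_apply_of, adjSwap]
    have key : ∀ a b c : Set.Icc 1 n, a ≠ b → a ≠ c → b ≠ c →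
        Equiv.swap a b * Equiv.swap b c * Equiv.swap a b =
          Equiv.swap b c * Equiv.swap a b * Equiv.swap b c := by
      intro a b c hab hac hbc
      rw [Equiv.swap_mul_swap_mul_swap hab hac, Equiv.swap_comm a b, Equiv.swap_comm b c,
        Equiv.swap_mul_swap_mul_swap hbc.symm hac.symm, Equiv.swap_comm]
    apply key <;> simp [Subtype.ext_iff, Nat.add_assoc]

/-- The homomorphism from `B_n` to the symmetric group, `σ_i ↦ (i, i+1)`. -/
def toPerm (n : ℕ) : B n →* Equiv.Perm (Set.Icc 1 n) :=
  PresentedGroup.toGroup (adjSwap_rels n)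

/-- The pure braid group `P_n`. -/
def P (n : ℕ) : Subgroup (B n) := (toPerm n).ker

theorem sigma_sq_mem (n i : ℕ) : sigma n i ^ 2 ∈ P n := by
  unfold P sigma
  rw [MonoidHom.mem_ker]
  split_ifs with h
  · simp [toPerm, adjSwap, pow_two]
  · simp

/-- `σ_{j-1} σ_{j-2} ⋯ σ_{i+1}`. -/
def desc (n i j : ℕ) : B n :=
  ((List.range' (i + 1) (j - 1 - i)).reverse.map (sigma n)).prod

/-- The standard generator
`A_{i,j} = σ_{j-1} ⋯ σ_{i+1} σ_i² σ_{i+1}⁻¹ ⋯ σ_{j-1}⁻¹` of `P_n`, for `1 ≤ i < j ≤ n`. -/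
def A (n i j : ℕ) : P n :=
  ⟨desc n i j * sigma n i ^ 2 * (desc n i j)⁻¹,
    (MonoidHom.normal_ker (toPerm n)).conj_mem _ (sigma_sq_mem n i) _⟩

/-- `x_i = A_{i,k+1}` in `P_{k+1}`. -/
def x (k i : ℕ) : P (k + 1) := A (k + 1) i (k + 1)

/-- `y_i = A_{i,i+1} A_{i,i+2} ⋯ A_{i,k}` in `P_{k+1}`; in particular `y_k = 1`. -/
def y (k i : ℕ) : P (k + 1) := ((List.range' (i + 1) (k - i)).map (A (k + 1) i)).prod

/-- `p_i = x_i x_{i+1} ⋯ x_k` in `P_{k+1}`; in particular `p_{k+1} = 1`. -/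
def p (k i : ℕ) : P (k + 1) := ((List.range' i (k + 1 - i)).map (x k)).prod

end Braid

/-!
The three statements are proved by induction along the tower `K_1, G_1, K_2, G_2, …`.

* In the relations of `G_k` the generator `p_k` occurs only in relations saying that it commutes with
  the generators of `A_k`. So `G_k` maps to the HNN extension of `K_k` whose stable letter `t`
  centralizes `A_k`. If `L_k` is free on its generators and meets `A_k` trivially, Britton's lemma
  (`FreeDisjoint.eq_one_of_lift_withStable_mem`) shows that `⟨L_k, t⟩` is the free product
  of `L_k` and `⟨t⟩` and still meets `A_k` trivially. Since `y_{k-1} p_{k-1}` commutes with `t`, the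
  element `y_{k-1} x_{k-1} y_{k-1}` equals `t⁻¹ (y_{k-1} p_{k-1} y_{k-1})`, and so `⟨L_k, t⟩` is the
  image of `H_k`. This gives the statements on `H_k` (`PG.freeInterCyclic_and_freeDisjoint`).
* The generator `y_k` is central in `K_{k+1}`, which maps to `G_k × ℤ`. The projection to `G_k` maps
  the generators of `L_{k+1}` to those of `H_k`, and `A_{k+1}` into `⟨A_k, p_k⟩`. An element of
  `L_{k+1} ∩ A_{k+1}` thus projects to some `p_k ^ n`. Its exponent of `y_k` is `2n` as it lies in
  `L_{k+1}`, and `n` as it lies in `A_{k+1}`, so that `n = 0` (`PG.freeDisjoint_succ`).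

Only homomorphisms out of the presented groups are needed: a homomorphism that maps generators
to a basis of a free group is injective on the subgroup they generate.

For the pure braid group, `G_k` is shown to embed in `P_{k+1}`. The relations hold because
`y_i = (σ_i ⋯ σ_{k-1})(σ_{k-1} ⋯ σ_i)` and `p_i = (σ_k ⋯ σ_i)(σ_i ⋯ σ_k)` (`Braid.exists_hom`). For
injectivity (`Braid.injective_of_map_p_y`), an element of `G_k` is a word `f` in the `p_i` times
a word in the `y_i`. In Artin's representation the `y_i` fix `z_{k+1}`, and `f` conjugates it by
an element that determines `f` modulo `z_{k+1}`; so `f = 1` if the product is trivial. A word in the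
`y_i` that is trivial as a braid then commutes with all `p_i`, which forces it to be trivial.
-/

/-! ### Free families in HNN extensions with trivially acting stable letter -/

theorem FreeGroup.induction_left {α : Type*} {C : FreeGroup α → Prop} (f : FreeGroup α)
    (one : C 1) (of_mul : ∀ a g, C g → C (FreeGroup.of a * g))
    (inv_of_mul : ∀ a g, C g → C ((FreeGroup.of a)⁻¹ * g)) : C f := by
  have hf : f ∈ Subgroup.closure (Set.range (FreeGroup.of : α → FreeGroup α)) := by
    rw [FreeGroup.closure_range_of]; trivial
  induction hf using Subgroup.closure_induction_left with
  | one => exact one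
  | mul_left x hx y hy ih => obtain ⟨a, rfl⟩ := hx; exact of_mul _ _ ih
  | inv_mul_cancel x hx y hy ih => obtain ⟨a, rfl⟩ := hx; exact inv_of_mul _ _ ih

/-- Every element of the free product of a free group with the infinite cyclic group generated
by the letter `none` has an expression `h₀ t^{u₁} h₁ ⋯ t^{uₙ} hₙ` without a subword
`t^u · 1 · t^{-u}`. -/
theorem FreeGroup.exists_reduced_option {ι : Type*} (f : FreeGroup (Option ι)) :
    ∃ (h : FreeGroup ι) (w : List (ℤˣ × FreeGroup ι)),
      w.IsChain (fun a b => a.2 = 1 → a.1 = b.1) ∧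
      f = FreeGroup.map some h *
        (w.map fun c => FreeGroup.of none ^ (c.1 : ℤ) * FreeGroup.map some c.2).prod := by
  have key : ∀ (u : ℤˣ) (h : FreeGroup ι) (w : List (ℤˣ × FreeGroup ι)),
      w.IsChain (fun a b => a.2 = 1 → a.1 = b.1) →
      ∃ (h' : FreeGroup ι) (w' : List (ℤˣ × FreeGroup ι)),
        w'.IsChain (fun a b => a.2 = 1 → a.1 = b.1) ∧
        FreeGroup.of none ^ (u : ℤ) * (FreeGroup.map some h *
          (w.map fun c => FreeGroup.of none ^ (c.1 : ℤ) * FreeGroup.map some c.2).prod) =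
        FreeGroup.map some h' *
          (w'.map fun c => FreeGroup.of none ^ (c.1 : ℤ) * FreeGroup.map some c.2).prod := by
    intro u h w hw
    by_cases hcan : h = 1 ∧ ∃ c w₀, w = c :: w₀ ∧ c.1 ≠ u
    · obtain ⟨rfl, c, w₀, rfl, hc⟩ := hcan
      refine ⟨c.2, w₀, (List.isChain_cons.1 hw).2, ?_⟩
      have hc' : c.1 = -u := by
        rcases Int.units_eq_one_or u with rfl | rfl <;>
          rcases Int.units_eq_one_or c.1 with h | h <;> simp_all
      simp [hc', mul_assoc]
    · refine ⟨1, (u, h) :: w, List.isChain_cons.2 ⟨?_, hw⟩, by simp [mul_assoc]⟩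
      intro c hc h1
      by_contra hne
      cases w with
      | nil => simp at hc
      | cons c' w₀ =>
        simp only [List.head?_cons, Option.mem_some_iff] at hc
        exact hcan ⟨h1, c', w₀, rfl, hc ▸ fun e => hne e.symm⟩
  induction f using FreeGroup.induction_left with
  | one => exact ⟨1, [], List.isChain_nil, by simp⟩
  | of_mul a g ih =>
    obtain ⟨h, w, hw, rfl⟩ := ih
    cases a with
    | none => simpa using key 1 h w hw
    | some a => exact ⟨FreeGroup.of a * h, w, hw, by simp [mul_assoc]⟩
  | inv_of_mul a g ih =>
    obtain ⟨h, w, hw, rfl⟩ := ih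
    cases a with
    | none => simpa using key (-1) h w hw
    | some a => exact ⟨(FreeGroup.of a)⁻¹ * h, w, hw, by simp [mul_assoc]⟩

section Families

variable {Γ Γ' ι κ : Type*} [Group Γ] [Group Γ']

/-- The family `l` is a basis of a free subgroup that meets the subgroup generated by the family
`a` trivially. -/
structure FreeDisjoint (l : ι → Γ) (a : κ → Γ) : Prop where
  inj : Function.Injective (FreeGroup.lift l)
  inf_eq_bot : Subgroup.closure (Set.range l) ⊓ Subgroup.closure (Set.range a) = ⊥

/-- The family `h` is a basis of a free subgroup whose intersection with the subgroup generated by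
the family `a` and the element `q` consists of powers of `q`. -/
structure FreeInterCyclic (h : ι → Γ) (a : κ → Γ) (q : Γ) : Prop where
  inj : Function.Injective (FreeGroup.lift h)
  inf_le : Subgroup.closure (Set.range h) ⊓
    (Subgroup.closure (Set.range a) ⊔ Subgroup.zpowers q) ≤ Subgroup.zpowers q

theorem lift_comp_hom (f : Γ →* Γ') (l : ι → Γ) :
    FreeGroup.lift (f ∘ l) = f.comp (FreeGroup.lift l) := by
  ext i; simp

theorem closure_range_comp (f : Γ →* Γ') (l : ι → Γ) :
    Subgroup.closure (Set.range (f ∘ l)) = (Subgroup.closure (Set.range l)).map f := by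
  rw [MonoidHom.map_closure, Set.range_comp]

theorem mem_closure_range (l : ι → Γ) (i : ι) : l i ∈ Subgroup.closure (Set.range l) :=
  Subgroup.subset_closure ⟨i, rfl⟩

theorem mem_closure_range_iff {l : ι → Γ} {g : Γ} :
    g ∈ Subgroup.closure (Set.range l) ↔ ∃ w, FreeGroup.lift l w = g := by
  rw [← FreeGroup.range_lift_eq_closure]; rfl

/-- A homomorphism that maps a family to a basis of a free group is injective on the subgroup
generated by the family. -/
theorem eq_of_map_eq {l : ι → Γ} (f : Γ →* Γ') (hinj : Function.Injective (FreeGroup.lift (f ∘ l)))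
    {g g' : Γ} (hg : g ∈ Subgroup.closure (Set.range l))
    (hg' : g' ∈ Subgroup.closure (Set.range l)) (h : f g = f g') : g = g' := by
  obtain ⟨w, rfl⟩ := mem_closure_range_iff.1 hg
  obtain ⟨w', rfl⟩ := mem_closure_range_iff.1 hg'
  rw [lift_comp_hom] at hinj
  rw [hinj h]

theorem injective_lift_of_comp {l : ι → Γ} (f : Γ →* Γ')
    (hinj : Function.Injective (FreeGroup.lift (f ∘ l))) :
    Function.Injective (FreeGroup.lift l) := by
  rw [lift_comp_hom, MonoidHom.coe_comp] at hinj
  exact hinj.of_comp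

theorem FreeDisjoint.of_comp {l : ι → Γ} {a : κ → Γ} (f : Γ →* Γ')
    (h : FreeDisjoint (f ∘ l) (f ∘ a)) : FreeDisjoint l a where
  inj := injective_lift_of_comp f h.inj
  inf_eq_bot := by
    rw [eq_bot_iff]
    rintro g ⟨hl, ha⟩
    have : f g ∈ (⊥ : Subgroup Γ') := by
      rw [← h.inf_eq_bot, closure_range_comp, closure_range_comp]
      exact ⟨Subgroup.mem_map_of_mem f hl, Subgroup.mem_map_of_mem f ha⟩
    exact eq_of_map_eq f h.inj hl (one_mem _) (by simpa using this)

theorem FreeDisjoint.comp {l : ι → Γ} {a : κ → Γ} (h : FreeDisjoint l a) {f : Γ →* Γ'}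
    (hf : Function.Injective f) : FreeDisjoint (f ∘ l) (f ∘ a) where
  inj := by rw [lift_comp_hom]; exact hf.comp h.inj
  inf_eq_bot := by
    rw [closure_range_comp, closure_range_comp, ← Subgroup.map_inf_eq _ _ _ hf, h.inf_eq_bot,
      Subgroup.map_bot]

theorem FreeInterCyclic.of_comp {h : ι → Γ} {a : κ → Γ} {q : Γ} (f : Γ →* Γ')
    (hq : q ∈ Subgroup.closure (Set.range h))
    (H : FreeInterCyclic (f ∘ h) (f ∘ a) (f q)) : FreeInterCyclic h a q where
  inj := injective_lift_of_comp f H.inj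
  inf_le := by
    rintro g ⟨hh, ha⟩
    have : f g ∈ Subgroup.zpowers (f q) := by
      apply H.inf_le
      rw [closure_range_comp, closure_range_comp, ← MonoidHom.map_zpowers, ← Subgroup.map_sup]
      exact ⟨Subgroup.mem_map_of_mem f hh, Subgroup.mem_map_of_mem f ha⟩
    obtain ⟨n, hn⟩ := Subgroup.mem_zpowers_iff.1 this
    refine Subgroup.mem_zpowers_iff.2 ⟨n, ?_⟩
    exact eq_of_map_eq f H.inj (zpow_mem hq n) hh (by simpa using hn)

theorem FreeInterCyclic.comp {h : ι → Γ} {a : κ → Γ} {q : Γ} (H : FreeInterCyclic h a q)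
    {f : Γ →* Γ'} (hf : Function.Injective f) : FreeInterCyclic (f ∘ h) (f ∘ a) (f q) where
  inj := by rw [lift_comp_hom]; exact hf.comp H.inj
  inf_le := by
    rw [closure_range_comp, closure_range_comp, ← MonoidHom.map_zpowers, ← Subgroup.map_sup,
      ← Subgroup.map_inf_eq _ _ _ hf]
    exact Subgroup.map_mono H.inf_le

theorem mem_sup_zpowers_of_commute {S : Subgroup Γ} {q g : Γ} (hq : ∀ s ∈ S, Commute q s)
    (hg : g ∈ S ⊔ Subgroup.zpowers q) : ∃ s ∈ S, ∃ n : ℤ, g = s * q ^ n := by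
  let T : Subgroup Γ :=
    { carrier := {g | ∃ s ∈ S, ∃ n : ℤ, g = s * q ^ n}
      mul_mem' := by
        rintro _ _ ⟨s, hs, n, rfl⟩ ⟨s', hs', n', rfl⟩
        refine ⟨s * s', mul_mem hs hs', n + n', ?_⟩
        rw [zpow_add, mul_assoc s, ← mul_assoc (q ^ n), ((hq s' hs').zpow_left n).eq]
        simp only [mul_assoc]
      one_mem' := ⟨1, one_mem _, 0, by simp⟩
      inv_mem' := by
        rintro _ ⟨s, hs, n, rfl⟩
        refine ⟨s⁻¹, inv_mem hs, -n, ?_⟩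
        rw [mul_inv_rev, zpow_neg, (((hq s hs).zpow_left n).inv_inv).eq] }
  have hT : S ⊔ Subgroup.zpowers q ≤ T := by
    refine sup_le (fun s hs => ⟨s, hs, 0, by simp⟩) ?_
    rw [Subgroup.zpowers_le]
    exact ⟨1, one_mem _, 1, by simp⟩
  exact hT hg

/-- The HNN extension of `Γ` whose stable letter centralizes `A`. -/
abbrev CentralHNN (A : Subgroup Γ) : Type _ := HNNExtension Γ A A (MulEquiv.refl A)

/-- The family `l` in the HNN extension, enlarged by the stable letter. -/
def withStable (A : Subgroup Γ) (l : ι → Γ) : Option ι → CentralHNN A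
  | none => HNNExtension.t
  | some i => HNNExtension.of (l i)

/-- Britton's lemma: the free product of `⟨l⟩` and `⟨t⟩` maps to the HNN extension so
that only the trivial element is sent into the centralized subgroup `⟨a⟩`. -/
theorem FreeDisjoint.eq_one_of_lift_withStable_mem {l : ι → Γ} {a : κ → Γ} (H : FreeDisjoint l a)
    {f : FreeGroup (Option ι)} {c : Γ} (hc : c ∈ Subgroup.closure (Set.range a))
    (hf : FreeGroup.lift (withStable (Subgroup.closure (Set.range a)) l) f =
      HNNExtension.of c) : f = 1 := by
  set A := Subgroup.closure (Set.range a)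
  have hA : ∀ h : FreeGroup ι, FreeGroup.lift l h ∈ A → h = 1 := by
    intro h hh
    have : FreeGroup.lift l h ∈ (⊥ : Subgroup Γ) := by
      rw [← H.inf_eq_bot]
      exact ⟨mem_closure_range_iff.2 ⟨h, rfl⟩, hh⟩
    exact H.inj (by simpa using this)
  have hsub : ∀ u : ℤˣ, HNNExtension.toSubgroup A A u = A := by
    intro u; rcases Int.units_eq_one_or u with rfl | rfl <;> rfl
  have hmap : ∀ h : FreeGroup ι, FreeGroup.lift (withStable A l) (FreeGroup.map some h) =
      HNNExtension.of (FreeGroup.lift l h) := by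
    intro h
    have : (FreeGroup.lift (withStable A l)).comp (FreeGroup.map some) =
        HNNExtension.of.comp (FreeGroup.lift l) := by
      ext i; simp [withStable]
    exact DFunLike.congr_fun this h
  obtain ⟨h, w, hw, rfl⟩ := f.exists_reduced_option
  let w₁ : HNNExtension.NormalWord.ReducedWord Γ A A :=
    { head := FreeGroup.lift l h
      toList := w.map fun c => (c.1, FreeGroup.lift l c.2)
      chain := by
        rw [List.isChain_map]
        refine hw.imp fun b b' hb h' => hb (hA _ ?_)
        simpa [hsub] using h' }
  let w₂ : HNNExtension.NormalWord.ReducedWord Γ A A := ⟨c, [], List.isChain_nil⟩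
  have hprod : w₁.prod (MulEquiv.refl A) = w₂.prod (MulEquiv.refl A) := by
    have : w₂.prod (MulEquiv.refl A) = HNNExtension.of c := by
      simp [HNNExtension.NormalWord.ReducedWord.prod, w₂]
    rw [this, ← hf, map_mul, hmap, map_list_prod]
    simp only [HNNExtension.NormalWord.ReducedWord.prod, w₁, List.map_map]
    congr 3
    funext b
    simp only [Function.comp, map_mul, map_zpow, FreeGroup.lift_apply_of, withStable, hmap]
  have hnil := (HNNExtension.ReducedWord.map_fst_eq_and_of_prod_eq _ hprod).1
  have hw0 : w = [] := by simpa [w₁, w₂] using hnil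
  subst hw0
  have hh : FreeGroup.lift l h = c :=
    HNNExtension.of_injective _ (by simpa [hmap] using hf)
  simp [hA h (hh ▸ hc)]

end Families

/-! ### The groups `G_k` and `K_k` -/

section Fam

variable {Γ Γ' : Type*} [Group Γ] [Group Γ']

/-- The generators of `A_{m+1}`, as a family. -/
def famA (x p y : ℕ → Γ) (m : ℕ) (i : Fin m) : Γ :=
  y (i + 1) * (if (i : ℕ) + 1 < m then x (i + 1) else p (i + 1))

/-- The generators of `L_{m+1}`, as a family. -/
def famL (x p y : ℕ → Γ) (m : ℕ) (i : Fin m) : Γ :=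
  y (i + 1) * (if (i : ℕ) + 1 < m then x (i + 1) else p (i + 1)) * y (i + 1)

/-- The generators of `H_m`, as a family. -/
def famH (x y : ℕ → Γ) (m : ℕ) (i : Fin m) : Γ := y (i + 1) * x (i + 1) * y (i + 1)

theorem subA_succ (x p y : ℕ → Γ) (m : ℕ) :
    subA x p y (m + 1) = Subgroup.closure (Set.range (famA x p y m)) := by
  rw [subA]
  congr 1
  ext g
  constructor
  · rintro (⟨i, h1, h2, rfl⟩ | ⟨i, h1, h2, rfl⟩)
    all_goals
      obtain ⟨i, rfl⟩ : ∃ j, i = j + 1 := ⟨i - 1, by omega⟩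
      exact ⟨⟨i, by omega⟩, by simp only [famA]; split_ifs <;> first | rfl | omega⟩
  · rintro ⟨⟨i, hi⟩, rfl⟩
    by_cases h : i + 1 < m
    · exact Or.inl ⟨i + 1, by omega, by omega, by simp [famA, h]⟩
    · exact Or.inr ⟨i + 1, by omega, by omega, by simp [famA, h]⟩

theorem subL_succ (x p y : ℕ → Γ) (m : ℕ) :
    subL x p y (m + 1) = Subgroup.closure (Set.range (famL x p y m)) := by
  rw [subL]
  congr 1
  ext g
  constructor
  · rintro (⟨i, h1, h2, rfl⟩ | ⟨i, h1, h2, rfl⟩)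
    all_goals
      obtain ⟨i, rfl⟩ : ∃ j, i = j + 1 := ⟨i - 1, by omega⟩
      exact ⟨⟨i, by omega⟩, by simp only [famL]; split_ifs <;> first | rfl | omega⟩
  · rintro ⟨⟨i, hi⟩, rfl⟩
    by_cases h : i + 1 < m
    · exact Or.inl ⟨i + 1, by omega, by omega, by simp [famL, h]⟩
    · exact Or.inr ⟨i + 1, by omega, by omega, by simp [famL, h]⟩

theorem subH_eq (x y : ℕ → Γ) (m : ℕ) :
    subH x y m = Subgroup.closure (Set.range (famH x y m)) := by
  rw [subH]
  congr 1
  ext g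
  constructor
  · rintro ⟨i, h1, h2, rfl⟩
    obtain ⟨i, rfl⟩ : ∃ j, i = j + 1 := ⟨i - 1, by omega⟩
    exact ⟨⟨i, by omega⟩, rfl⟩
  · rintro ⟨⟨i, hi⟩, rfl⟩
    exact ⟨i + 1, by omega, by omega, rfl⟩

theorem FreeDisjoint.subL_inf_subA {x p y : ℕ → Γ} {m : ℕ}
    (h : FreeDisjoint (famL x p y m) (famA x p y m)) :
    subL x p y (m + 1) ⊓ subA x p y (m + 1) = ⊥ := by
  rw [subL_succ, subA_succ, h.inf_eq_bot]

theorem FreeInterCyclic.nonempty_subH_equiv {x y : ℕ → Γ} {m : ℕ} {κ : Type*} {a : κ → Γ} {q : Γ}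
    (h : FreeInterCyclic (famH x y m) a q) : Nonempty (subH x y m ≃* FreeGroup (Fin m)) := by
  rw [subH_eq, ← FreeGroup.range_lift_eq_closure]
  exact ⟨(MonoidHom.ofInjective h.inj).symm⟩

theorem FreeInterCyclic.subH_inf {x p y : ℕ → Γ} {m : ℕ} {q : Γ}
    (hq : q ∈ Subgroup.closure (Set.range (famH x y (m + 1))))
    (h : FreeInterCyclic (famH x y (m + 1)) (famA x p y m) q) :
    subH x y (m + 1) ⊓ (subA x p y (m + 1) ⊔ Subgroup.zpowers q) = Subgroup.zpowers q := by
  rw [subH_eq, subA_succ]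
  refine le_antisymm h.inf_le (le_inf ?_ le_sup_right)
  rwa [Subgroup.zpowers_le]

end Fam

namespace PG

variable {r s : ℕ}

theorem p_eq_one {i : ℕ} (h : ¬(1 ≤ i ∧ i ≤ r)) : p r s i = 1 := by
  simp [p, wp, h]

theorem y_eq_one {i : ℕ} (h : ¬(1 ≤ i ∧ i ≤ s)) : y r s i = 1 := by
  simp [y, wy, h]

theorem of_inl (i : Set.Icc 1 r) : PresentedGroup.of (Sum.inl i) = p r s i := by
  have := i.2
  simp only [Set.mem_Icc] at this
  simp [p, wp, this, PresentedGroup.of]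

theorem of_inr (j : Set.Icc 1 s) : PresentedGroup.of (Sum.inr j) = y r s j := by
  have := j.2
  simp only [Set.mem_Icc] at this
  simp [y, wy, this, PresentedGroup.of]

theorem commute_y_y (i j : ℕ) : Commute (y r s i) (y r s j) := by
  by_cases hi : 1 ≤ i ∧ i ≤ s
  · by_cases hj : 1 ≤ j ∧ j ≤ s
    · rw [← commutatorElement_eq_one_iff_commute, y, y, ← map_commutatorElement]
      exact PresentedGroup.one_of_mem (Or.inl (Or.inl ⟨i, hi, j, hj, rfl⟩))
    · rw [y_eq_one hj]; exact Commute.one_right _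
  · rw [y_eq_one hi]; exact Commute.one_left _

theorem commute_p_y {i j : ℕ} (hij : i ≤ j) : Commute (p r s i) (y r s j) := by
  by_cases hi : 1 ≤ i ∧ i ≤ r
  · by_cases hj : 1 ≤ j ∧ j ≤ s
    · rw [← commutatorElement_eq_one_iff_commute, y, p, ← map_commutatorElement]
      exact PresentedGroup.one_of_mem (Or.inl (Or.inr ⟨i, hi, j, hj, hij, rfl⟩))
    · rw [y_eq_one hj]; exact Commute.one_right _
  · rw [p_eq_one hi]; exact Commute.one_left _

theorem commute_p_mul {i j : ℕ} (hj : 1 ≤ j) (hjs : j ≤ s) (hij : j < i) :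
    Commute (p r s i) (y r s j * p r s j * (p r s (j + 1))⁻¹) := by
  by_cases hi : 1 ≤ i ∧ i ≤ r
  · rw [← commutatorElement_eq_one_iff_commute, y, p, p, p, ← map_mul, ← map_inv, ← map_mul,
      ← map_commutatorElement]
    exact PresentedGroup.one_of_mem (Or.inr ⟨i, hi, j, ⟨hj, hjs⟩, hij, rfl⟩)
  · rw [p_eq_one hi]; exact Commute.one_left _

/-- The universal property of the presentation, for sequences extended by `1`. -/
theorem exists_lift {Γ : Type*} [Group Γ] (P Y : ℕ → Γ)
    (hP : ∀ i, ¬(1 ≤ i ∧ i ≤ r) → P i = 1) (hY : ∀ i, ¬(1 ≤ i ∧ i ≤ s) → Y i = 1)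
    (hYY : ∀ i j, 1 ≤ i → i ≤ s → 1 ≤ j → j ≤ s → Commute (Y i) (Y j))
    (hPY : ∀ i j, 1 ≤ i → i ≤ r → j ≤ s → i ≤ j → Commute (P i) (Y j))
    (hPX : ∀ i j, 1 ≤ j → j ≤ s → j < i → i ≤ r → Commute (P i) (Y j * P j * (P (j + 1))⁻¹)) :
    ∃ f : Grp r s →* Γ, (∀ i, f (p r s i) = P i) ∧ ∀ j, f (y r s j) = Y j := by
  let g : Gens r s → Γ := Sum.elim (fun i => P i) (fun j => Y j)
  have gp : ∀ i, FreeGroup.lift g (wp r s i) = P i := by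
    intro i
    unfold wp
    split_ifs with h
    · simp [g]
    · simp [hP i h]
  have gy : ∀ i, FreeGroup.lift g (wy r s i) = Y i := by
    intro i
    unfold wy
    split_ifs with h
    · simp [g]
    · simp [hY i h]
  have hg : ∀ w ∈ rels r s, FreeGroup.lift g w = 1 := by
    rintro w ((⟨i, hi, j, hj, rfl⟩ | ⟨i, hi, j, hj, hij, rfl⟩) | ⟨i, hi, j, hj, hij, rfl⟩) <;>
      simp only [map_commutatorElement, map_mul, map_inv, gp, gy,
        commutatorElement_eq_one_iff_commute]
    · exact hYY i j hi.1 hi.2 hj.1 hj.2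
    · exact hPY i j hi.1 hi.2 hj.2 hij
    · exact hPX i j hj.1 hj.2 hij hi.2
  exact ⟨PresentedGroup.toGroup hg, gp, gy⟩

theorem p_mem_closure_famH (m : ℕ) : p (m + 1) m (m + 1) ∈
    Subgroup.closure (Set.range (famH (x (m + 1) m) (y (m + 1) m) (m + 1))) := by
  refine Subgroup.subset_closure ⟨Fin.last m, ?_⟩
  have h1 : y (m + 1) m (m + 1) = 1 := y_eq_one (by omega)
  have h2 : p (m + 1) m (m + 1 + 1) = 1 := p_eq_one (by omega)
  simp [famH, x, h1, h2]

/-- The passage from `L_k` to `H_k`: the generator `p_k` is a stable letter over `K_k` that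
centralizes `A_k`, and `H_k` is generated by `L_k` and `p_k`. -/
theorem freeInterCyclic_and_freeDisjoint (m : ℕ)
    (H : FreeDisjoint (famL (x m m) (p m m) (y m m) m) (famA (x m m) (p m m) (y m m) m)) :
    FreeInterCyclic (famH (x (m + 1) m) (y (m + 1) m) (m + 1))
      (famA (x (m + 1) m) (p (m + 1) m) (y (m + 1) m) m) (p (m + 1) m (m + 1)) ∧
    FreeDisjoint (famL (x (m + 1) m) (p (m + 1) m) (y (m + 1) m) m)
      (famA (x (m + 1) m) (p (m + 1) m) (y (m + 1) m) m) := by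
  set a := famA (x m m) (p m m) (y m m) m with ha
  set l := famL (x m m) (p m m) (y m m) m with hl
  set A := Subgroup.closure (Set.range a)
  let τ : CentralHNN A := HNNExtension.t
  have hτ : ∀ c ∈ A, Commute τ (HNNExtension.of c) := fun c hc =>
    HNNExtension.t_mul_of (⟨c, hc⟩ : A)
  -- The relations of `G_k` that involve `p_k` say that `p_k` commutes with the generators of `A_k`.
  obtain ⟨f, fp, fy⟩ : ∃ f : Grp (m + 1) m →* CentralHNN A,
      (∀ i, f (p (m + 1) m i) = if i = m + 1 then τ else HNNExtension.of (p m m i)) ∧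
      ∀ j, f (y (m + 1) m j) = HNNExtension.of (y m m j) := by
    apply exists_lift
    · intro i hi
      rw [if_neg (by omega), p_eq_one (by omega), map_one]
    · intro i hi
      rw [y_eq_one hi, map_one]
    · intro i j _ _ _ _
      exact (commute_y_y i j).map _
    · intro i j _ _ hj hij
      rw [if_neg (by omega)]
      exact (commute_p_y hij).map _
    · intro i j hj1 hj hji hi
      rw [if_neg (show j ≠ m + 1 by omega)]
      have haj := mem_closure_range a ⟨j - 1, by omega⟩
      by_cases him : i = m + 1
      · rw [if_pos him]
        have haj' := hτ _ haj
        simp only [ha, famA, Nat.sub_add_cancel hj1] at haj'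
        by_cases hjm : j < m
        · rw [if_neg (by omega)]
          rw [if_pos hjm, x] at haj'
          simpa [mul_assoc] using haj'
        · rw [if_pos (by omega)]
          rw [if_neg hjm, map_mul] at haj'
          exact haj'.mul_right (Commute.refl τ).inv_right
      · rw [if_neg him, if_neg (by omega)]
        simpa using (commute_p_mul (r := m) hj1 hj hji).map
          (HNNExtension.of : Grp m m →* CentralHNN A)
  have hfx : ∀ i, i + 1 < m → f (x (m + 1) m (i + 1)) = HNNExtension.of (x m m (i + 1)) := by
    intro i hi
    simp only [x, map_mul, map_inv, fp]
    rw [if_neg (by omega), if_neg (by omega)]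
  have hfa : f ∘ famA (x (m + 1) m) (p (m + 1) m) (y (m + 1) m) m = HNNExtension.of ∘ a := by
    funext i
    simp only [ha, Function.comp, famA, map_mul, fy]
    split_ifs with h
    · rw [hfx _ h]
    · rw [fp, if_neg (by omega)]
  have hfl : f ∘ famL (x (m + 1) m) (p (m + 1) m) (y (m + 1) m) m = HNNExtension.of ∘ l := by
    funext i
    simp only [hl, Function.comp, famL, map_mul, fy]
    split_ifs with h
    · rw [hfx _ h]
    · rw [fp, if_neg (by omega)]
  refine ⟨FreeInterCyclic.of_comp f (p_mem_closure_famH m) ?_, ?_⟩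
  swap
  · refine FreeDisjoint.of_comp f ?_
    rw [hfa, hfl]
    exact H.comp (HNNExtension.of_injective _)
  rw [hfa, fp, if_pos rfl]
  -- In terms of the basis `l₁, …, l_m, t` of `⟨L_k, p_k⟩`, the last two generators of `H_k`
  -- are `t⁻¹ l_m` and `t`.
  let ν : Fin (m + 1) → FreeGroup (Option (Fin m)) := Fin.lastCases (FreeGroup.of none)
    fun i => if (i : ℕ) + 1 < m then FreeGroup.of (some i)
      else (FreeGroup.of none)⁻¹ * FreeGroup.of (some i)
  let ν' : Option (Fin m) → FreeGroup (Fin (m + 1)) := fun o => o.elim (FreeGroup.of (Fin.last m))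
    fun i => if (i : ℕ) + 1 < m then FreeGroup.of i.castSucc
      else FreeGroup.of (Fin.last m) * FreeGroup.of i.castSucc
  have hν : Function.Injective (FreeGroup.lift ν) := by
    refine Function.LeftInverse.injective (g := FreeGroup.lift ν') fun w => ?_
    have : (FreeGroup.lift ν').comp (FreeGroup.lift ν) = MonoidHom.id _ := by
      ext i
      induction i using Fin.lastCases with
      | last => simp [ν, ν']
      | cast i =>
        by_cases h : (i : ℕ) + 1 < m <;> simp [ν, ν', h]
    exact DFunLike.congr_fun this w
  have hfh : f ∘ famH (x (m + 1) m) (y (m + 1) m) (m + 1) =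
      FreeGroup.lift (withStable A l) ∘ ν := by
    funext i
    induction i using Fin.lastCases with
    | last =>
      have h1 : y m m (m + 1) = 1 := y_eq_one (by omega)
      have h2 : p m m (m + 1 + 1) = 1 := p_eq_one (by omega)
      simp [famH, ν, withStable, x, fp, fy, h1, h2, τ]
    | cast i =>
      by_cases h : (i : ℕ) + 1 < m
      · have := hfx i h
        simp [famH, ν, withStable, hl, famL, h, fy, this]
      · have haj := hτ _ (mem_closure_range a i)
        simp only [ha, famA, h, if_false, map_mul] at haj
        have him : (i : ℕ) + 1 = m := by omega
        have e : ∀ Y P : CentralHNN A, Commute τ (Y * P) →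
            Y * (P * τ⁻¹) * Y = τ⁻¹ * (Y * P * Y) := by
          intro Y P hc
          rw [← mul_assoc Y, ← mul_assoc τ⁻¹, ← hc.inv_left.eq]
        have := e _ _ haj
        simp only [famH, x, Function.comp, map_mul, map_inv, fp, fy, Fin.val_castSucc, ν,
          Fin.lastCases_castSucc, h, if_false, FreeGroup.lift_apply_of, withStable, hl, famL]
        rw [if_neg (by omega), if_pos (by omega)]
        exact this
  have hinj : Function.Injective (FreeGroup.lift (withStable A l)) := by
    rw [injective_iff_map_eq_one]
    intro w hw
    exact H.eq_one_of_lift_withStable_mem (one_mem _) (by rw [hw, map_one])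
  rw [hfh]
  refine ⟨by rw [lift_comp_hom]; exact hinj.comp hν, ?_⟩
  rintro g ⟨hg1, hg2⟩
  rw [closure_range_comp] at hg1 hg2
  obtain ⟨w, -, rfl⟩ := hg1
  obtain ⟨b, ⟨c, hc, rfl⟩, n, hn⟩ := mem_sup_zpowers_of_commute
    (by rintro _ ⟨c, hc, rfl⟩; exact hτ c hc) hg2
  have hw : w * FreeGroup.of none ^ (-n) = 1 := by
    refine H.eq_one_of_lift_withStable_mem hc ?_
    rw [map_mul, map_zpow, FreeGroup.lift_apply_of]
    change _ * τ ^ (-n) = _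
    rw [hn, zpow_neg, mul_inv_cancel_right]
  have hw' : w = FreeGroup.of none ^ n := by
    rw [zpow_neg] at hw; exact mul_inv_eq_one.1 hw
  refine Subgroup.mem_zpowers_iff.2 ⟨n, ?_⟩
  rw [hw', map_zpow, FreeGroup.lift_apply_of]
  rfl

/-- The passage from `H_k` to `L_{k+1}`: the group `K_{k+1}` maps to `G_k × ℤ`, where `y_k` is
sent to the generator of the second factor, and `L_{k+1}` projects isomorphically to `H_k`. -/
theorem freeDisjoint_succ (m : ℕ)
    (H : FreeInterCyclic (famH (x (m + 1) m) (y (m + 1) m) (m + 1))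
      (famA (x (m + 1) m) (p (m + 1) m) (y (m + 1) m) m) (p (m + 1) m (m + 1))) :
    FreeDisjoint
      (famL (x (m + 1) (m + 1)) (p (m + 1) (m + 1)) (y (m + 1) (m + 1)) (m + 1))
      (famA (x (m + 1) (m + 1)) (p (m + 1) (m + 1)) (y (m + 1) (m + 1)) (m + 1)) := by
  set h := famH (x (m + 1) m) (y (m + 1) m) (m + 1) with hh
  set a := famA (x (m + 1) m) (p (m + 1) m) (y (m + 1) m) m with ha
  let z : Multiplicative ℤ := Multiplicative.ofAdd 1
  obtain ⟨f, fp, fy⟩ : ∃ f : Grp (m + 1) (m + 1) →* Grp (m + 1) m × Multiplicative ℤ,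
      (∀ i, f (p (m + 1) (m + 1) i) = (p (m + 1) m i, 1)) ∧
      ∀ j, f (y (m + 1) (m + 1) j) = (y (m + 1) m j, if j = m + 1 then z else 1) := by
    apply exists_lift
    · intro i hi
      rw [p_eq_one hi]; rfl
    · intro i hi
      rw [y_eq_one (by omega), if_neg (by omega)]; rfl
    · intro i j _ _ _ _
      exact Commute.prod (commute_y_y i j) (Commute.all _ _)
    · intro i j _ _ hj hij
      exact Commute.prod (commute_p_y hij) (Commute.all _ _)
    · intro i j hj1 hj hji hi
      exact Commute.prod (commute_p_mul hj1 (by omega) hji) (Commute.all _ _)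
  refine FreeDisjoint.of_comp f ?_
  set l' := f ∘ famL (x (m + 1) (m + 1)) (p (m + 1) (m + 1)) (y (m + 1) (m + 1)) (m + 1) with hl'
  set a' := f ∘ famA (x (m + 1) (m + 1)) (p (m + 1) (m + 1)) (y (m + 1) (m + 1)) (m + 1) with ha'
  let π := MonoidHom.fst (Grp (m + 1) m) (Multiplicative ℤ)
  have hp0 : p (m + 1) m (m + 1 + 1) = 1 := p_eq_one (by omega)
  have hy0 : y (m + 1) m (m + 1) = 1 := y_eq_one (by omega)
  have hπl : π ∘ l' = h := by
    funext i
    simp only [Function.comp, hl', hh, famL, famH]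
    split_ifs with hi
    · simp [π, x, fp, fy]
    · have him : (i : ℕ) + 1 = m + 1 := by omega
      simp [π, x, fp, fy, him, hp0]
  have hinj : Function.Injective (FreeGroup.lift l') :=
    injective_lift_of_comp π (by rw [hπl]; exact H.inj)
  refine ⟨hinj, ?_⟩
  have hπa : ∀ g ∈ Subgroup.closure (Set.range a'),
      π g ∈ Subgroup.closure (Set.range a) ⊔ Subgroup.zpowers (p (m + 1) m (m + 1)) := by
    suffices (Subgroup.closure (Set.range a')).map π ≤
        Subgroup.closure (Set.range a) ⊔ Subgroup.zpowers (p (m + 1) m (m + 1)) from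
      fun g hg => this (Subgroup.mem_map_of_mem π hg)
    rw [MonoidHom.map_closure, Subgroup.closure_le]
    rintro _ ⟨_, ⟨i, rfl⟩, rfl⟩
    have hpm : p (m + 1) m (m + 1) ∈
        Subgroup.closure (Set.range a) ⊔ Subgroup.zpowers (p (m + 1) m (m + 1)) :=
      le_sup_right (a := Subgroup.closure (Set.range a)) (Subgroup.mem_zpowers _)
    induction i using Fin.lastCases with
    | last => simpa [ha', famA, π, fp, fy, hy0] using hpm
    | cast i =>
      have hai : a i ∈ Subgroup.closure (Set.range a) ⊔
          Subgroup.zpowers (p (m + 1) m (m + 1)) :=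
        le_sup_left (a := Subgroup.closure (Set.range a))
          (mem_closure_range a i)
      by_cases hi : (i : ℕ) + 1 < m
      · simpa [ha', ha, famA, π, fp, fy, hi, x] using hai
      · have him : (i : ℕ) + 1 = m := by omega
        have := mul_mem hai (inv_mem hpm)
        simpa [ha', ha, famA, π, fp, fy, hi, him, x, mul_assoc] using this
  -- The second component of an element of `A_{k+1}` is read off from the first one by
  -- the homomorphism `p_i ↦ 1`, `y_i ↦ 0` to `ℤ`.
  obtain ⟨χ, χp, χy⟩ : ∃ χ : Grp (m + 1) m →* Multiplicative ℤ,
      (∀ i, χ (p (m + 1) m i) = if 1 ≤ i ∧ i ≤ m + 1 then z else 1) ∧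
      ∀ j, χ (y (m + 1) m j) = 1 :=
    exists_lift _ _ (fun i hi => if_neg hi) (fun _ _ => rfl) (fun _ _ _ _ _ _ => Commute.all _ _)
      (fun _ _ _ _ _ _ => Commute.all _ _) (fun _ _ _ _ _ _ => Commute.all _ _)
  have hχ : ∀ g ∈ Subgroup.closure (Set.range a'), g.2 = χ g.1 := by
    intro g hg
    suffices Subgroup.closure (Set.range a') ≤
        (MonoidHom.snd (Grp (m + 1) m) (Multiplicative ℤ)).eqLocus (χ.comp π) from this hg
    rw [Subgroup.closure_le]
    rintro _ ⟨i, rfl⟩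
    change (a' i).2 = χ (a' i).1
    induction i using Fin.lastCases with
    | last => simp [ha', famA, fp, fy, χp, hy0]
    | cast i =>
      have := i.2
      simp [ha', famA, fp, fy, χp, χy, x, this, this.le, this.ne]
  rw [eq_bot_iff]
  rintro g ⟨hgl, hga⟩
  have hπg : π g ∈ Subgroup.zpowers (p (m + 1) m (m + 1)) := by
    refine H.inf_le ⟨?_, hπa g hga⟩
    rw [SetLike.mem_coe, ← hπl, closure_range_comp]
    exact Subgroup.mem_map_of_mem π hgl
  obtain ⟨n, hn⟩ := Subgroup.mem_zpowers_iff.1 hπg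
  have hlast : l' (Fin.last m) = (p (m + 1) m (m + 1), z * z) := by
    simp [hl', famL, fp, fy, hy0]
  have hgn : g = (p (m + 1) m (m + 1), z * z) ^ n := by
    rw [← hlast]
    refine eq_of_map_eq π (by rw [hπl]; exact H.inj) hgl
      (zpow_mem (mem_closure_range l' _) n) ?_
    rw [map_zpow, hlast, ← hn]
    rfl
  have h2 := hχ g hga
  rw [hgn] at h2
  simp only [Prod.pow_mk, map_zpow, χp] at h2
  rw [if_pos (by omega), mul_zpow] at h2
  -- The last generator `p_k y_k²` of `L_{k+1}` gives the exponent `2n` of `y_k`, while `χ` gives `n`.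
  have hn0 : n = 0 := by
    have : z ^ n = 1 := by simpa using h2
    have h3 := congrArg Multiplicative.toAdd this
    simpa [z] using h3
  rw [hgn, hn0, zpow_zero]
  exact one_mem _

/-- The subgroup `L_k` of `K_k` is free on its generators and meets `A_k` trivially. -/
theorem freeDisjoint_K (m : ℕ) :
    FreeDisjoint (famL (x m m) (p m m) (y m m) m) (famA (x m m) (p m m) (y m m) m) := by
  induction m with
  | zero =>
    refine ⟨Function.injective_of_subsingleton _, ?_⟩
    simp [Set.range_eq_empty]
  | succ m ih => exact freeDisjoint_succ m (freeInterCyclic_and_freeDisjoint m ih).1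

end PG

/-! ### The homomorphism from `G_k` to the pure braid group -/

namespace Braid

section Relations

variable (n : ℕ)

/-- The product `σ_i σ_{i+1} ⋯ σ_{i+d-1}`. -/
def ascProd (i d : ℕ) : B n := ((List.range' i d).map (sigma n)).prod

/-- The product `σ_{i+d-1} ⋯ σ_{i+1} σ_i`. -/
def descProd (i d : ℕ) : B n := ((List.range' i d).reverse.map (sigma n)).prod

variable {n}

theorem sigma_of_mem {i : ℕ} (h : 1 ≤ i ∧ i < n) : sigma n i = PresentedGroup.of ⟨i, h⟩ := by
  simp [sigma, h]

theorem sigma_of_not_mem {i : ℕ} (h : ¬(1 ≤ i ∧ i < n)) : sigma n i = 1 := by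
  simp [sigma, h]

theorem commute_sigma {i j : ℕ} (hij : i + 1 < j) : Commute (sigma n i) (sigma n j) := by
  by_cases hi : 1 ≤ i ∧ i < n
  · by_cases hj : 1 ≤ j ∧ j < n
    · rw [sigma_of_mem hi, sigma_of_mem hj]
      exact PresentedGroup.mk_eq_mk_of_mul_inv_mem (Or.inl ⟨⟨i, hi⟩, ⟨j, hj⟩, hij, rfl⟩)
    · rw [sigma_of_not_mem hj]; exact Commute.one_right _
  · rw [sigma_of_not_mem hi]; exact Commute.one_left _

theorem sigma_braid {i : ℕ} (hi : 1 ≤ i) (hn : i + 1 < n) :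
    sigma n i * sigma n (i + 1) * sigma n i = sigma n (i + 1) * sigma n i * sigma n (i + 1) := by
  rw [sigma_of_mem (i := i) ⟨hi, by omega⟩, sigma_of_mem (i := i + 1) ⟨by omega, hn⟩]
  exact PresentedGroup.mk_eq_mk_of_mul_inv_mem
    (Or.inr ⟨⟨i, hi, by omega⟩, ⟨i + 1, by omega, hn⟩, rfl, rfl⟩)

@[simp] theorem ascProd_zero (i : ℕ) : ascProd n i 0 = 1 := rfl

@[simp] theorem descProd_zero (i : ℕ) : descProd n i 0 = 1 := rfl

theorem ascProd_succ (i d : ℕ) : ascProd n i (d + 1) = ascProd n i d * sigma n (i + d) := by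
  simp [ascProd, List.range'_concat]

theorem ascProd_succ' (i d : ℕ) : ascProd n i (d + 1) = sigma n i * ascProd n (i + 1) d := by
  simp [ascProd, List.range'_succ]

theorem descProd_succ (i d : ℕ) : descProd n i (d + 1) = sigma n (i + d) * descProd n i d := by
  simp [descProd, List.range'_concat]

theorem descProd_succ' (i d : ℕ) : descProd n i (d + 1) = descProd n (i + 1) d * sigma n i := by
  simp [descProd, List.range'_succ]

theorem commute_ascProd {g : B n} {i d : ℕ}
    (h : ∀ m, i ≤ m → m < i + d → Commute g (sigma n m)) : Commute g (ascProd n i d) := by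
  induction d with
  | zero => exact Commute.one_right _
  | succ d ih =>
    rw [ascProd_succ]
    exact (ih fun m h1 h2 => h m h1 (by omega)).mul_right (h _ (by omega) (by omega))

theorem commute_descProd {g : B n} {i d : ℕ}
    (h : ∀ m, i ≤ m → m < i + d → Commute g (sigma n m)) : Commute g (descProd n i d) := by
  induction d with
  | zero => exact Commute.one_right _
  | succ d ih =>
    rw [descProd_succ]
    exact (h _ (by omega) (by omega)).mul_right (ih fun m h1 h2 => h m h1 (by omega))

theorem descProd_mul_sigma {i d m : ℕ} (hi : 1 ≤ i) (him : i ≤ m) (hm : m + 1 < i + d)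
    (hn : i + d ≤ n) : descProd n i d * sigma n (m + 1) = sigma n m * descProd n i d := by
  induction d with
  | zero => omega
  | succ d ih =>
    by_cases h : m + 1 < i + d
    · rw [descProd_succ, mul_assoc, ih h (by omega), ← mul_assoc, ← mul_assoc,
        (commute_sigma h).eq]
    · obtain ⟨d, rfl⟩ : ∃ e, d = e + 1 := ⟨d - 1, by omega⟩
      obtain rfl : m = i + d := by omega
      have hc : Commute (sigma n (i + d + 1)) (descProd n i d) :=
        commute_descProd fun m h1 h2 => (commute_sigma (by omega)).symm
      rw [descProd_succ, descProd_succ, ← add_assoc, mul_assoc, mul_assoc, ← hc.eq,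
        ← mul_assoc, ← mul_assoc, ← mul_assoc, ← mul_assoc, sigma_braid (by omega) (by omega)]

theorem ascProd_mul_sigma {i d m : ℕ} (hi : 1 ≤ i) (him : i ≤ m) (hm : m + 1 < i + d)
    (hn : i + d ≤ n) : ascProd n i d * sigma n m = sigma n (m + 1) * ascProd n i d := by
  induction d with
  | zero => omega
  | succ d ih =>
    by_cases h : m + 1 < i + d
    · rw [ascProd_succ, mul_assoc, ← (commute_sigma h).eq, ← mul_assoc, ih h (by omega),
        ← mul_assoc]
    · obtain ⟨d, rfl⟩ : ∃ e, d = e + 1 := ⟨d - 1, by omega⟩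
      obtain rfl : m = i + d := by omega
      have hc : Commute (sigma n (i + d + 1)) (ascProd n i d) :=
        commute_ascProd fun m h1 h2 => (commute_sigma (by omega)).symm
      have hb := sigma_braid (n := n) (i := i + d) (by omega) (by omega)
      rw [ascProd_succ, ascProd_succ, ← add_assoc, ← mul_assoc, ← mul_assoc, hc.eq]
      simp only [mul_assoc] at hb ⊢
      rw [hb]

theorem commute_sigma_asc_mul_desc {i d m : ℕ} (hi : 1 ≤ i) (him : i < m) (hm : m < i + d)
    (hn : i + d ≤ n) : Commute (ascProd n i d * descProd n i d) (sigma n m) := by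
  obtain ⟨m, rfl⟩ : ∃ e, m = e + 1 := ⟨m - 1, by omega⟩
  rw [Commute, SemiconjBy, mul_assoc, descProd_mul_sigma hi (by omega) hm hn, ← mul_assoc,
    ascProd_mul_sigma hi (by omega) hm hn, mul_assoc]

theorem commute_sigma_desc_mul_asc {i d m : ℕ} (hi : 1 ≤ i) (him : i ≤ m) (hm : m + 1 < i + d)
    (hn : i + d ≤ n) : Commute (descProd n i d * ascProd n i d) (sigma n m) := by
  rw [Commute, SemiconjBy, mul_assoc, ascProd_mul_sigma hi him hm hn, ← mul_assoc,
    descProd_mul_sigma hi him hm hn, mul_assoc]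

theorem coe_A_eq (i d : ℕ) : (A n i (i + d + 1) : B n) =
    descProd n (i + 1) d * sigma n i ^ 2 * (descProd n (i + 1) d)⁻¹ := by
  have : i + d + 1 - 1 - i = d := by omega
  simp only [A, desc, this, descProd]

/-- The expression `A_{i,j} = σ_i⁻¹ ⋯ σ_{j-2}⁻¹ σ_{j-1}² σ_{j-2} ⋯ σ_i`. -/
theorem coe_A_eq' {i d : ℕ} (hi : 1 ≤ i) (hn : i + d < n) : (A n i (i + d + 1) : B n) =
    (descProd n i d)⁻¹ * sigma n (i + d) ^ 2 * descProd n i d := by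
  rw [coe_A_eq]
  induction d with
  | zero => simp
  | succ d ih =>
    have hc : Commute (sigma n (i + d + 1)) (descProd n i d) :=
      commute_descProd fun m h1 h2 => (commute_sigma (by omega)).symm
    have hb := sigma_braid (n := n) (i := i + d) (by omega) (by omega)
    have e : sigma n (i + d + 1) * sigma n (i + d) ^ 2 * (sigma n (i + d + 1))⁻¹ =
        (sigma n (i + d))⁻¹ * sigma n (i + d + 1) ^ 2 * sigma n (i + d) := by
      rw [mul_inv_eq_iff_eq_mul, mul_assoc, mul_assoc, eq_inv_mul_iff_mul_eq]
      calc _ = sigma n (i + d) * sigma n (i + d + 1) * sigma n (i + d) * sigma n (i + d) := by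
            simp only [pow_two, mul_assoc]
        _ = sigma n (i + d + 1) * sigma n (i + d) * sigma n (i + d + 1) * sigma n (i + d) := by
            rw [hb]
        _ = sigma n (i + d + 1) * (sigma n (i + d) * sigma n (i + d + 1) * sigma n (i + d)) := by
            simp only [mul_assoc]
        _ = _ := by rw [hb]; simp only [pow_two, mul_assoc]
    rw [descProd_succ (i + 1), descProd_succ i, show i + 1 + d = i + d + 1 by omega, ← add_assoc]
    calc _ = sigma n (i + d + 1) * (descProd n (i + 1) d * sigma n i ^ 2 *
          (descProd n (i + 1) d)⁻¹) * (sigma n (i + d + 1))⁻¹ := by group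
      _ = (sigma n (i + d + 1) * (descProd n i d)⁻¹) * sigma n (i + d) ^ 2 *
          (descProd n i d * (sigma n (i + d + 1))⁻¹) := by rw [ih (by omega)]; group
      _ = (descProd n i d)⁻¹ *
          (sigma n (i + d + 1) * sigma n (i + d) ^ 2 * (sigma n (i + d + 1))⁻¹) *
          descProd n i d := by
        rw [hc.inv_right.eq, ← hc.inv_left.eq]; group
      _ = _ := by rw [e]; group

theorem coe_prod_A {i d : ℕ} (hi : 1 ≤ i) (hn : i + d ≤ n) :
    ((((List.range' (i + 1) d).map (A n i)).prod : P n) : B n) =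
      ascProd n i d * descProd n i d := by
  induction d with
  | zero => simp
  | succ d ih =>
    rw [List.range'_concat, List.map_append, List.prod_append, Subgroup.coe_mul, ih (by omega)]
    simp only [List.map_cons, List.map_nil, List.prod_cons, List.prod_nil, mul_one, one_mul]
    rw [show i + 1 + d = i + d + 1 by omega, coe_A_eq' hi (by omega), ascProd_succ, descProd_succ,
      pow_two]
    group

theorem coe_prod_A_right (i d : ℕ) :
    ((((List.range' i d).map fun m => A n m (i + d)).prod : P n) : B n) =
      descProd n i d * ascProd n i d := by
  induction d generalizing i with
  | zero => simp
  | succ d ih =>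
    rw [List.range'_succ, List.map_cons, List.prod_cons, Subgroup.coe_mul, ← add_assoc,
      coe_A_eq, show i + d + 1 = i + 1 + d by omega, ih, ascProd_succ', descProd_succ', pow_two]
    group

end Relations

section PureBraid

variable {k : ℕ}

/-- The braid `y_i` takes the strand `i` once around the strands `i + 1, …, k`. -/
theorem coe_y {i : ℕ} (hi : 1 ≤ i) (hik : i ≤ k) :
    (y k i : B (k + 1)) = ascProd (k + 1) i (k - i) * descProd (k + 1) i (k - i) :=
  coe_prod_A hi (by omega)

/-- The braid `p_i` takes the last strand once around the strands `i, …, k`. -/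
theorem coe_p {i : ℕ} (hik : i ≤ k) : (p k i : B (k + 1)) =
    descProd (k + 1) i (k + 1 - i) * ascProd (k + 1) i (k + 1 - i) := by
  rw [← coe_prod_A_right, Nat.add_sub_cancel' (by omega)]
  rfl

theorem p_eq_one {i : ℕ} (hi : k < i) : p k i = 1 := by
  simp [p, show k + 1 - i = 0 by omega]

theorem y_eq_one {i : ℕ} (hi : k ≤ i) : y k i = 1 := by
  simp [y, show k - i = 0 by omega]

theorem p_eq_x_mul {i : ℕ} (hi : i ≤ k) : p k i = x k i * p k (i + 1) := by
  rw [p, p, show k + 1 - i = (k + 1 - (i + 1)) + 1 by omega, List.range'_succ, List.map_cons,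
    List.prod_cons]

theorem coe_y_mul_x {i : ℕ} (hi : 1 ≤ i) (hik : i ≤ k) : ((y k i * x k i : P (k + 1)) : B (k + 1)) =
    ascProd (k + 1) i (k + 1 - i) * descProd (k + 1) i (k + 1 - i) := by
  rw [← coe_prod_A hi (by omega), show k + 1 - i = (k - i) + 1 by omega, List.range'_concat,
    List.map_append, List.prod_append]
  simp [y, x, show i + 1 + (k - i) = k + 1 by omega]

theorem commute_y_y {i j : ℕ} (hi : 1 ≤ i) (hij : i < j) (hj : j ≤ k) :
    Commute (y k i) (y k j) := by
  have h : ∀ m, j ≤ m → m < j + (k - j) → Commute (y k i : B (k + 1)) (sigma (k + 1) m) := by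
    intro m h1 h2
    rw [coe_y hi (by omega)]
    exact commute_sigma_asc_mul_desc hi (by omega) (by omega) (by omega)
  refine Subtype.ext ?_
  rw [Subgroup.coe_mul, Subgroup.coe_mul, coe_y (i := j) (by omega) hj]
  exact (commute_ascProd h).mul_right (commute_descProd h)

theorem commute_p_y {i j : ℕ} (hi : 1 ≤ i) (hij : i ≤ j) (hj : j ≤ k) :
    Commute (p k i) (y k j) := by
  have h : ∀ m, j ≤ m → m < j + (k - j) → Commute (p k i : B (k + 1)) (sigma (k + 1) m) := by
    intro m h1 h2
    rw [coe_p (by omega)]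
    exact commute_sigma_desc_mul_asc hi (by omega) (by omega) (by omega)
  refine Subtype.ext ?_
  rw [Subgroup.coe_mul, Subgroup.coe_mul, coe_y (i := j) (by omega) hj]
  exact (commute_ascProd h).mul_right (commute_descProd h)

theorem commute_p_y_mul_x {i j : ℕ} (hj : 1 ≤ j) (hji : j < i) (hi : i ≤ k) :
    Commute (p k i) (y k j * x k j) := by
  have h : ∀ m, i ≤ m → m < i + (k + 1 - i) →
      Commute ((y k j * x k j : P (k + 1)) : B (k + 1)) (sigma (k + 1) m) := by
    intro m h1 h2
    rw [coe_y_mul_x hj (by omega)]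
    exact commute_sigma_asc_mul_desc hj (by omega) (by omega) (by omega)
  have h' : Commute ((y k j * x k j : P (k + 1)) : B (k + 1)) (p k i) := by
    rw [coe_p hi]
    exact (commute_descProd h).mul_right (commute_ascProd h)
  exact Subtype.ext h'.symm.eq

/-- The elements `p_i`, `y_i` of the pure braid group satisfy the relations of `G_k`. -/
theorem exists_hom (k : ℕ) : ∃ f : GGrp k →* P (k + 1),
    (∀ i, 1 ≤ i → f (PG.p k (k - 1) i) = p k i) ∧
    (∀ i, 1 ≤ i → f (PG.y k (k - 1) i) = y k i) := by
  obtain ⟨f, fp, fy⟩ : ∃ f : GGrp k →* P (k + 1),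
      (∀ i, f (PG.p k (k - 1) i) = if 1 ≤ i then p k i else 1) ∧
      (∀ i, f (PG.y k (k - 1) i) = if 1 ≤ i then y k i else 1) := by
    apply PG.exists_lift
    · intro i hi
      split_ifs with h
      · exact p_eq_one (by omega)
      · rfl
    · intro i hi
      split_ifs with h
      · exact y_eq_one (by omega)
      · rfl
    · intro i j hi hi' hj hj'
      rw [if_pos hi, if_pos hj]
      rcases lt_trichotomy i j with h | rfl | h
      · exact commute_y_y hi h (by omega)
      · exact Commute.refl _
      · exact (commute_y_y hj h (by omega)).symm
    · intro i j hi hi' hj hij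
      rw [if_pos hi, if_pos (by omega)]
      exact commute_p_y hi hij (by omega)
    · intro i j hj hj' hji hi
      rw [if_pos hj, if_pos hj, if_pos (by omega), if_pos (by omega), p_eq_x_mul (i := j) (by omega),
        ← mul_assoc, mul_inv_cancel_right]
      exact commute_p_y_mul_x hj hji hi
  exact ⟨f, fun i hi => by rw [fp, if_pos hi], fun i hi => by rw [fy, if_pos hi]⟩

end PureBraid

end Braid

/-! ### Artin's representation -/

namespace Braid

/-- Artin's automorphism `z_i ↦ z_i z_{i+1} z_i⁻¹`, `z_{i+1} ↦ z_i` of the free group on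
`z_0, z_1, …`. -/
def artinAut (i : ℕ) : MulAut (FreeGroup ℕ) :=
  MonoidHom.toMulEquiv
    (FreeGroup.lift fun m => if m = i then FreeGroup.of i * FreeGroup.of (i + 1) *
      (FreeGroup.of i)⁻¹ else if m = i + 1 then FreeGroup.of i else FreeGroup.of m)
    (FreeGroup.lift fun m => if m = i then FreeGroup.of (i + 1) else
      if m = i + 1 then (FreeGroup.of (i + 1))⁻¹ * FreeGroup.of i * FreeGroup.of (i + 1)
      else FreeGroup.of m)
    (by
      ext m
      by_cases h1 : m = i
      · subst h1; simp [mul_assoc]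
      · by_cases h2 : m = i + 1
        · subst h2; simp
        · simp [h1, h2])
    (by
      ext m
      by_cases h1 : m = i
      · subst h1; simp
      · by_cases h2 : m = i + 1
        · subst h2; simp [mul_assoc]
        · simp [h1, h2])

theorem artinAut_of (i m : ℕ) : artinAut i (FreeGroup.of m) =
    if m = i then FreeGroup.of i * FreeGroup.of (i + 1) * (FreeGroup.of i)⁻¹
    else if m = i + 1 then FreeGroup.of i else FreeGroup.of m := by
  simp [artinAut]

theorem artinAut_self (i : ℕ) : artinAut i (FreeGroup.of i) =
    FreeGroup.of i * FreeGroup.of (i + 1) * (FreeGroup.of i)⁻¹ := by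
  simp [artinAut_of]

theorem artinAut_succ (i : ℕ) : artinAut i (FreeGroup.of (i + 1)) = FreeGroup.of i := by
  simp [artinAut_of]

theorem artinAut_of_ne {i m : ℕ} (h1 : m ≠ i) (h2 : m ≠ i + 1) :
    artinAut i (FreeGroup.of m) = FreeGroup.of m := by
  simp [artinAut_of, h1, h2]

theorem mulAut_ext {β γ : MulAut (FreeGroup ℕ)}
    (h : ∀ m, β (FreeGroup.of m) = γ (FreeGroup.of m)) : β = γ := by
  have : β.toMonoidHom = γ.toMonoidHom := by ext m; exact h m
  exact MulEquiv.toMonoidHom_injective this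

theorem artinAut_comm {i j : ℕ} (hij : i + 1 < j) :
    artinAut i * artinAut j = artinAut j * artinAut i := by
  refine mulAut_ext fun m => ?_
  simp only [MulAut.mul_apply]
  by_cases h1 : m = i
  · subst h1
    rw [artinAut_self, artinAut_of_ne (i := j) (by omega) (by omega), map_mul, map_mul, map_inv,
      artinAut_of_ne (i := j) (by omega) (by omega), artinAut_of_ne (i := j) (by omega) (by omega),
      artinAut_self]
  by_cases h2 : m = i + 1
  · subst h2
    rw [artinAut_succ, artinAut_of_ne (i := j) (by omega) (by omega), artinAut_succ,
      artinAut_of_ne (i := j) (by omega) (by omega)]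
  rw [artinAut_of_ne (i := i) h1 h2]
  by_cases h3 : m = j
  · subst h3
    rw [artinAut_self, map_mul, map_mul, map_inv,
      artinAut_of_ne (i := i) (by omega) (by omega), artinAut_of_ne (i := i) (by omega) (by omega)]
  by_cases h4 : m = j + 1
  · subst h4
    rw [artinAut_succ, artinAut_of_ne (i := i) (by omega) (by omega)]
  rw [artinAut_of_ne h3 h4, artinAut_of_ne h1 h2]

theorem artinAut_braid (i : ℕ) : artinAut i * artinAut (i + 1) * artinAut i =
    artinAut (i + 1) * artinAut i * artinAut (i + 1) := by
  refine mulAut_ext fun m => ?_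
  have e1 := artinAut_self i
  have e2 := artinAut_succ i
  have e3 := artinAut_self (i + 1)
  have e4 := artinAut_succ (i + 1)
  have e5 : artinAut (i + 1) (FreeGroup.of i) = FreeGroup.of i :=
    artinAut_of_ne (by omega) (by omega)
  have e6 : artinAut i (FreeGroup.of (i + 1 + 1)) = FreeGroup.of (i + 1 + 1) :=
    artinAut_of_ne (by omega) (by omega)
  simp only [MulAut.mul_apply]
  by_cases h1 : m = i
  · subst h1; simp only [e1, e2, e3, e5, e6, map_mul, map_inv]; group
  by_cases h2 : m = i + 1
  · subst h2; simp only [e1, e2, e3, e4, e5, e6, map_mul, map_inv]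
  by_cases h3 : m = i + 1 + 1
  · subst h3; simp only [e2, e4, e5, e6]
  simp only [artinAut_of_ne (i := i) h1 h2, artinAut_of_ne (i := i + 1) h2 h3]

/-- Artin's representation of the braid group by automorphisms of a free group. -/
def artin (n : ℕ) : B n →* MulAut (FreeGroup ℕ) :=
  PresentedGroup.toGroup (f := fun i : Set.Ico 1 n => artinAut i) (by
    rintro w (⟨i, j, hij, rfl⟩ | ⟨i, j, hij, rfl⟩)
    · simp only [map_mul, map_inv, FreeGroup.lift_apply_of, mul_inv_eq_one]
      exact artinAut_comm hij
    · simp only [map_mul, map_inv, FreeGroup.lift_apply_of, mul_inv_eq_one]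
      rw [← hij]
      exact artinAut_braid _)

variable {n : ℕ}

theorem artin_sigma {i : ℕ} (hi : 1 ≤ i) (hn : i < n) : artin n (sigma n i) = artinAut i := by
  rw [sigma_of_mem ⟨hi, hn⟩]
  exact PresentedGroup.toGroup.of _

theorem artin_ascProd_last {i d : ℕ} (hi : 1 ≤ i) (hn : i + d ≤ n) :
    artin n (ascProd n i d) (FreeGroup.of (i + d)) = FreeGroup.of i := by
  induction d generalizing i with
  | zero => simp
  | succ d ih =>
    rw [ascProd_succ', map_mul, MulAut.mul_apply, show i + (d + 1) = i + 1 + d by omega,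
      ih (by omega) (by omega), artin_sigma hi (by omega), artinAut_succ]

theorem artin_ascProd_of_ne {i d m : ℕ} (hi : 1 ≤ i) (hn : i + d ≤ n) (hm : m < i ∨ i + d < m) :
    artin n (ascProd n i d) (FreeGroup.of m) = FreeGroup.of m := by
  induction d generalizing i with
  | zero => simp
  | succ d ih =>
    rw [ascProd_succ', map_mul, MulAut.mul_apply, ih (by omega) (by omega) (by omega),
      artin_sigma hi (by omega), artinAut_of_ne (by omega) (by omega)]

theorem artin_ascProd_of_mem {i d m : ℕ} (hi : 1 ≤ i) (hn : i + d ≤ n) (him : i ≤ m)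
    (hm : m < i + d) : artin n (ascProd n i d) (FreeGroup.of m) =
      FreeGroup.of i * FreeGroup.of (m + 1) * (FreeGroup.of i)⁻¹ := by
  induction d generalizing i with
  | zero => omega
  | succ d ih =>
    rw [ascProd_succ', map_mul, MulAut.mul_apply, artin_sigma hi (by omega)]
    rcases him.eq_or_lt with rfl | him
    · rw [artin_ascProd_of_ne (by omega) (by omega) (by omega), artinAut_self]
    · rw [ih (by omega) (by omega) him (by omega), map_mul, map_mul, map_inv, artinAut_succ,
        artinAut_of_ne (by omega) (by omega)]

theorem artin_descProd_of_ne {i d m : ℕ} (hi : 1 ≤ i) (hn : i + d ≤ n) (hm : m < i ∨ i + d < m) :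
    artin n (descProd n i d) (FreeGroup.of m) = FreeGroup.of m := by
  induction d generalizing i with
  | zero => simp
  | succ d ih =>
    rw [descProd_succ', map_mul, MulAut.mul_apply, artin_sigma hi (by omega),
      artinAut_of_ne (by omega) (by omega), ih (by omega) (by omega) (by omega)]

theorem artin_descProd_succ {i d m : ℕ} (hi : 1 ≤ i) (hn : i + d ≤ n) (him : i ≤ m)
    (hm : m < i + d) : artin n (descProd n i d) (FreeGroup.of (m + 1)) = FreeGroup.of m := by
  induction d generalizing i with
  | zero => omega
  | succ d ih =>
    rw [descProd_succ', map_mul, MulAut.mul_apply, artin_sigma hi (by omega)]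
    rcases him.eq_or_lt with rfl | him
    · rw [artinAut_succ, artin_descProd_of_ne (by omega) (by omega) (by omega)]
    · rw [artinAut_of_ne (by omega) (by omega), ih (by omega) (by omega) him (by omega)]

/-- The product `z_i z_{i+1} ⋯ z_{i+d-1}`. -/
def zProd (i d : ℕ) : FreeGroup ℕ := ((List.range' i d).map FreeGroup.of).prod

theorem artin_descProd_first {i d : ℕ} (hi : 1 ≤ i) (hn : i + d ≤ n) :
    artin n (descProd n i d) (FreeGroup.of i) =
      zProd i d * FreeGroup.of (i + d) * (zProd i d)⁻¹ := by
  induction d generalizing i with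
  | zero => simp [zProd]
  | succ d ih =>
    rw [descProd_succ', map_mul, MulAut.mul_apply, artin_sigma hi (by omega), artinAut_self,
      map_mul, map_mul, map_inv, artin_descProd_of_ne (by omega) (by omega) (by omega),
      ih (by omega) (by omega), show i + (d + 1) = i + 1 + d by omega]
    simp [zProd, List.range'_succ, mul_assoc]

section Detection

variable (k : ℕ)

/-- The letter `X_i` of the free group of rank `k` for `1 ≤ i ≤ k`, and `1` for other indices. -/
def letter (i : ℕ) : FreeGroup (Fin k) :=
  if h : 1 ≤ i ∧ i ≤ k then FreeGroup.of ⟨i - 1, by omega⟩ else 1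

/-- The homomorphism `z_i ↦ X_i⁻¹ X_{i+1}`. It kills `z_{k+1}` and maps
`z_i z_{i+1} ⋯ z_k` to `X_i⁻¹` for `1 ≤ i ≤ k`. -/
def toLetters : FreeGroup ℕ →* FreeGroup (Fin k) :=
  FreeGroup.lift fun i => (letter k i)⁻¹ * letter k (i + 1)

variable {k}

theorem letter_eq_one {i : ℕ} (h : k < i) : letter k i = 1 := by
  rw [letter, dif_neg (by omega)]

theorem letter_succ (i : Fin k) : letter k (i + 1) = FreeGroup.of i := by
  simp [letter, Nat.succ_le_of_lt i.2]

theorem toLetters_last : toLetters k (FreeGroup.of (k + 1)) = 1 := by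
  rw [toLetters, FreeGroup.lift_apply_of, letter_eq_one (by omega), letter_eq_one (by omega)]
  simp

theorem toLetters_zProd (i d : ℕ) :
    toLetters k (zProd i d) = (letter k i)⁻¹ * letter k (i + d) := by
  induction d generalizing i with
  | zero => simp [zProd]
  | succ d ih =>
    have : zProd i (d + 1) = FreeGroup.of i * zProd (i + 1) d := by
      simp [zProd, List.range'_succ]
    rw [this, map_mul, ih, toLetters, FreeGroup.lift_apply_of, show i + (d + 1) = i + 1 + d by omega]
    group

/-- The centralizer of `z_{k+1}` is contained in the kernel of `toLetters`. -/
theorem toLetters_eq_one_of_commute {v : FreeGroup ℕ} (hv : Commute v (FreeGroup.of (k + 1))) :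
    toLetters k v = 1 := by
  classical
  let F := FreeGroup (Fin k)
  -- Let `z_i` act on two copies of the free group of rank `k` by translation by `toLetters z_i`,
  -- except that `z_{k+1}` exchanges the two copies of `1`.
  let s : Equiv.Perm (F × Bool) := Equiv.swap (1, false) (1, true)
  let θ : FreeGroup ℕ →* Equiv.Perm (F × Bool) := FreeGroup.lift fun i =>
    if i = k + 1 then s
    else Equiv.prodCongr (Equiv.mulLeft (toLetters k (FreeGroup.of i))) (Equiv.refl Bool)
  have hs : ∀ c, (s c).1 = c.1 := by
    intro c
    simp only [s, Equiv.swap_apply_def]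
    split_ifs with h h <;> simp [h]
  have hθ : ∀ i c, (θ (FreeGroup.of i) c).1 = toLetters k (FreeGroup.of i) * c.1 := by
    intro i c
    by_cases h : i = k + 1
    · subst h
      rw [toLetters_last, one_mul, FreeGroup.lift_apply_of, if_pos rfl, hs]
    · simp [θ, h]
  have key : ∀ w c, (θ w c).1 = toLetters k w * c.1 := by
    intro w
    induction w using FreeGroup.induction_left with
    | one => simp
    | of_mul a g ih => intro c; rw [map_mul, Equiv.Perm.mul_apply, hθ, ih, map_mul, mul_assoc]
    | inv_of_mul a g ih =>
      intro c
      have h := hθ a (θ ((FreeGroup.of a)⁻¹ * g) c)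
      rw [← Equiv.Perm.mul_apply, ← map_mul, mul_inv_cancel_left, ih] at h
      rw [map_mul (toLetters k), map_inv (toLetters k), mul_assoc, h, inv_mul_cancel_left]
  have hsθ : θ (FreeGroup.of (k + 1)) = s := by simp [θ]
  by_contra hne
  have hc := congrArg (fun e : Equiv.Perm (F × Bool) => e (1, false)) (hv.map θ).eq
  simp only [Equiv.Perm.mul_apply, hsθ] at hc
  have h1 : s (1, false) = (1, true) := Equiv.swap_apply_left _ _
  have h2 : s (θ v (1, false)) = θ v (1, false) := by
    have h3 : (θ v (1, false)).1 ≠ 1 := by rw [key]; simpa using hne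
    exact Equiv.swap_apply_of_ne_of_ne (fun h => h3 (by rw [h])) (fun h => h3 (by rw [h]))
  rw [h1, h2] at hc
  simpa using (θ v).injective hc

theorem toLetters_artin_p {i : ℕ} (hi : 1 ≤ i) (hik : i ≤ k) :
    (∀ u, toLetters k (artin (k + 1) (p k i) u) = toLetters k u) ∧
    ∃ v, artin (k + 1) (p k i) (FreeGroup.of (k + 1)) = v⁻¹ * FreeGroup.of (k + 1) * v ∧
      toLetters k v = letter k i := by
  have hd : i + (k + 1 - i) = k + 1 := by omega
  have hfirst := artin_descProd_first (n := k + 1) (d := k + 1 - i) hi hd.le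
  have hasc := artin_ascProd_last (n := k + 1) (d := k + 1 - i) hi hd.le
  rw [hd] at hfirst hasc
  constructor
  · suffices (toLetters k).comp (artin (k + 1) (p k i)).toMonoidHom = toLetters k from
      fun u => DFunLike.congr_fun this u
    ext m
    change toLetters k (artin (k + 1) (p k i) (FreeGroup.of m)) = _
    rw [coe_p hik, map_mul, MulAut.mul_apply]
    by_cases hm : m < i ∨ i + (k + 1 - i) < m
    · rw [artin_ascProd_of_ne hi hd.le hm, artin_descProd_of_ne hi hd.le hm]
    · by_cases hm' : m = k + 1
      · subst hm'
        rw [hasc, hfirst]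
        simp [toLetters_last]
      · rw [artin_ascProd_of_mem hi hd.le (by omega) (by omega)]
        simp only [map_mul, map_inv]
        rw [artin_descProd_succ hi hd.le (by omega) (by omega), hfirst]
        simp [toLetters_last]
  · refine ⟨(zProd i (k + 1 - i))⁻¹, ?_, ?_⟩
    · rw [coe_p hik, map_mul, MulAut.mul_apply, hasc, hfirst, inv_inv]
    · rw [map_inv, toLetters_zProd, hd, letter_eq_one (i := k + 1) (by omega)]
      simp

/-- A word `f` in the `p_i` conjugates `z_{k+1}` by an element that `toLetters` maps to `f`. -/
theorem exists_artin_lift_p (f : FreeGroup (Fin k)) :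
    ∃ v, artin (k + 1) (FreeGroup.lift (fun i : Fin k => p k (i + 1)) f : P (k + 1))
        (FreeGroup.of (k + 1)) = v⁻¹ * FreeGroup.of (k + 1) * v ∧ toLetters k v = f := by
  let S : Subgroup (MulAut (FreeGroup ℕ) × FreeGroup (Fin k)) :=
    { carrier := {b | (∀ u, toLetters k (b.1 u) = toLetters k u) ∧
        ∃ v, b.1 (FreeGroup.of (k + 1)) = v⁻¹ * FreeGroup.of (k + 1) * v ∧ toLetters k v = b.2}
      one_mem' := ⟨fun _ => rfl, 1, by simp, by simp⟩
      mul_mem' := by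
        rintro ⟨b, f⟩ ⟨b', f'⟩ ⟨hb, v, hv, hf⟩ ⟨hb', v', hv', hf'⟩
        refine ⟨fun u => by simp_all, v * b v', ?_, ?_⟩
        · simp only [Prod.mk_mul_mk, MulAut.mul_apply] at *
          rw [hv', map_mul, map_mul, map_inv, hv]
          group
        · simp only [Prod.mk_mul_mk] at *
          rw [map_mul, hb, hf, hf']
      inv_mem' := by
        rintro ⟨b, f⟩ ⟨hb, v, hv, hf⟩
        have hb' : ∀ u, toLetters k (b⁻¹ u) = toLetters k u := by
          intro u
          rw [← hb (b⁻¹ u)]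
          simp
        refine ⟨hb', (b⁻¹ v)⁻¹, ?_, ?_⟩
        · have := congrArg (b⁻¹ : MulAut (FreeGroup ℕ)) hv
          simp only [map_mul, map_inv, MulAut.inv_apply_self] at this
          simp only [Prod.inv_mk, inv_inv]
          calc b⁻¹ (FreeGroup.of (k + 1)) = b⁻¹ v *
                ((b⁻¹ v)⁻¹ * b⁻¹ (FreeGroup.of (k + 1)) * b⁻¹ v) * (b⁻¹ v)⁻¹ := by
                  simp only [mul_assoc, mul_inv_cancel_left, mul_inv_cancel, mul_one]
            _ = _ := by rw [← this]
        · simp only [Prod.inv_mk] at *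
          rw [map_inv, hb', hf] }
  let Φ : FreeGroup (Fin k) →* MulAut (FreeGroup ℕ) × FreeGroup (Fin k) :=
    (((artin (k + 1)).comp (P (k + 1)).subtype).comp
      (FreeGroup.lift fun i : Fin k => p k (i + 1))).prod (MonoidHom.id _)
  have hΦ : Φ f ∈ S := by
    induction f using FreeGroup.induction_on with
    | C1 => rw [map_one]; exact one_mem _
    | of i =>
      have := toLetters_artin_p (k := k) (i := i + 1) (by omega) (by omega)
      rw [letter_succ] at this
      simpa [Φ, S] using this
    | inv_of i h => rw [map_inv]; exact inv_mem h
    | mul a b ha hb => rw [map_mul]; exact mul_mem ha hb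
  exact hΦ.2

theorem artin_y_last {i : ℕ} (hi : 1 ≤ i) (hik : i ≤ k) :
    artin (k + 1) (y k i) (FreeGroup.of (k + 1)) = FreeGroup.of (k + 1) := by
  rw [coe_y hi hik, map_mul, MulAut.mul_apply, artin_descProd_of_ne hi (by omega) (by omega),
    artin_ascProd_of_ne hi (by omega) (by omega)]

end Detection

end Braid

/-! ### Normal forms in `G_k` -/

theorem FreeGroup.eq_zero_of_commute_of {α : Type*} {a b : α} (hab : a ≠ b) {n : ℤ}
    (h : Commute (FreeGroup.of a ^ n) (FreeGroup.of b)) : n = 0 := by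
  classical
  -- The free group maps to the infinite dihedral group of permutations of `ℤ`.
  let θ : FreeGroup α →* Equiv.Perm ℤ := FreeGroup.lift fun c =>
    if c = a then Equiv.addRight 1 else Equiv.neg ℤ
  have h1 := congrArg (fun e : Equiv.Perm ℤ => e 0) (h.map θ).eq
  simp [θ, hab.symm] at h1
  omega

namespace PG

/-- The homomorphism from the free group to `G_k` that sends the letters to `p_1, …, p_k`. -/
def liftP (k : ℕ) : FreeGroup (Fin k) →* GGrp k :=
  FreeGroup.lift fun i : Fin k => p k (k - 1) (i + 1)

/-- The subgroup of `G_k` generated by the `y_i` with `i ≥ j`. -/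
def subY (k j : ℕ) : Subgroup (GGrp k) := Subgroup.closure {g | ∃ i, j ≤ i ∧ g = y k (k - 1) i}

variable {k : ℕ}

theorem liftP_of (i : Fin k) : liftP k (FreeGroup.of i) = p k (k - 1) (i + 1) :=
  FreeGroup.lift_apply_of

theorem p_mem_range_liftP (i : ℕ) : p k (k - 1) i ∈ (liftP k).range := by
  by_cases h : 1 ≤ i ∧ i ≤ k
  · exact ⟨FreeGroup.of ⟨i - 1, by omega⟩, by rw [liftP_of]; simp [h.1]⟩
  · rw [p_eq_one h]; exact one_mem _

/-- For `j < i` the relations say that `y_j x_j` commutes with `p_i`, so that conjugation by `y_j`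
acts on `p_i` like conjugation by a word in the `p`'s. -/
theorem y_conj_p_mem (i j : ℕ) :
    y k (k - 1) j * p k (k - 1) i * (y k (k - 1) j)⁻¹ ∈ (liftP k).range ∧
    (y k (k - 1) j)⁻¹ * p k (k - 1) i * y k (k - 1) j ∈ (liftP k).range := by
  set P := p k (k - 1) with hP
  set Y := y k (k - 1) with hY
  have hmem : ∀ i, P i ∈ (liftP k).range := p_mem_range_liftP
  by_cases hj : 1 ≤ j ∧ j ≤ k - 1
  swap
  · rw [hY, y_eq_one hj]; simpa using hmem i
  rcases le_or_gt i j with hij | hij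
  · have hc : Commute (P i) (Y j) := commute_p_y hij
    rw [hc.symm.mul_inv_cancel, mul_assoc, hc.eq, inv_mul_cancel_left]
    exact ⟨hmem i, hmem i⟩
  · have hc : Commute (P i) (Y j * P j * (P (j + 1))⁻¹) := commute_p_mul hj.1 hj.2 hij
    have hc1 : Commute (P (j + 1)) (Y j * P j * (P (j + 1))⁻¹) :=
      commute_p_mul hj.1 hj.2 (Nat.lt_succ_self j)
    have hc2 : Commute (P j) (Y j) := commute_p_y le_rfl
    have hx : P j * (P (j + 1))⁻¹ ∈ (liftP k).range := mul_mem (hmem _) (inv_mem (hmem _))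
    have hx' : (P (j + 1))⁻¹ * P j ∈ (liftP k).range := mul_mem (inv_mem (hmem _)) (hmem _)
    have e2 : (Y j)⁻¹ * P i * Y j = P j * (P (j + 1))⁻¹ * P i * (P j * (P (j + 1))⁻¹)⁻¹ := by
      rw [eq_mul_inv_iff_mul_eq, mul_assoc, mul_assoc, inv_mul_eq_iff_eq_mul]
      simpa only [mul_assoc] using hc.eq
    have e0 : Commute (P (j + 1)) (Y j * P j) := by
      simpa using hc1.mul_right (Commute.refl (P (j + 1)))
    have e1 : Y j * (P j * (P (j + 1))⁻¹) * (Y j)⁻¹ = (P (j + 1))⁻¹ * P j := by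
      rw [mul_inv_eq_iff_eq_mul, mul_assoc (P (j + 1))⁻¹, hc2.eq, e0.inv_left.eq, mul_assoc]
    have e3 : Y j * P i * (Y j)⁻¹ =
        ((P (j + 1))⁻¹ * P j)⁻¹ * P i * ((P (j + 1))⁻¹ * P j) := by
      rw [← e1]
      have h1 : P i = Y j * (P j * (P (j + 1))⁻¹) * P i * (Y j * (P j * (P (j + 1))⁻¹))⁻¹ := by
        rw [eq_mul_inv_iff_mul_eq]
        simpa only [mul_assoc] using hc.eq
      conv_rhs => rw [h1]
      group
    rw [e2, e3]
    exact ⟨mul_mem (mul_mem (inv_mem hx') (hmem i)) hx',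
      mul_mem (mul_mem hx (hmem i)) (inv_mem hx)⟩

theorem normal_range_liftP (k : ℕ) : (liftP k).range.Normal := by
  rw [← Subgroup.normalizer_eq_top_iff, eq_top_iff, ← PresentedGroup.closure_range_of,
    Subgroup.closure_le]
  have hconj : ∀ g : GGrp k, (∀ i, g * p k (k - 1) i * g⁻¹ ∈ (liftP k).range) →
      ∀ h ∈ (liftP k).range, g * h * g⁻¹ ∈ (liftP k).range := by
    intro g hg
    suffices (liftP k).range ≤ (liftP k).range.comap (MulAut.conj g).toMonoidHom from
      fun h hh => this hh
    refine FreeGroup.range_lift_le ?_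
    rintro _ ⟨i, rfl⟩
    exact hg _
  rintro _ ⟨i | j, rfl⟩
  · refine Subgroup.le_normalizer ?_
    rw [of_inl]
    exact p_mem_range_liftP _
  · rw [of_inr, SetLike.mem_coe, Subgroup.mem_normalizer_iff]
    intro h
    refine ⟨hconj _ (fun i => (y_conj_p_mem i j).1) h, fun hh => ?_⟩
    have := hconj (y k (k - 1) j)⁻¹
      (fun i => by rw [inv_inv]; exact (y_conj_p_mem i j).2) _ hh
    simpa [mul_assoc] using this

/-- Every element of `G_k` is a word in the `p_i` followed by a word in the `y_i`. -/
theorem exists_liftP_mul (g : GGrp k) : ∃ w, ∃ c ∈ subY k 1, g = liftP k w * c := by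
  have := normal_range_liftP k
  have hg : g ∈ (liftP k).range ⊔ subY k 1 := by
    suffices (⊤ : Subgroup (GGrp k)) ≤ (liftP k).range ⊔ subY k 1 from this trivial
    rw [← PresentedGroup.closure_range_of, Subgroup.closure_le]
    rintro _ ⟨i | j, rfl⟩
    · refine le_sup_left (a := (liftP k).range) ?_
      rw [of_inl]
      exact p_mem_range_liftP _
    · refine le_sup_right (a := (liftP k).range) (Subgroup.subset_closure ⟨j, j.2.1, of_inr j⟩)
  obtain ⟨_, ⟨w, rfl⟩, c, hc, rfl⟩ := Subgroup.mem_sup_of_normal_left.1 hg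
  exact ⟨w, c, hc, rfl⟩

theorem commute_of_mem_subY {i j : ℕ} (hij : i ≤ j) {c : GGrp k} (hc : c ∈ subY k j) :
    Commute (p k (k - 1) i) c := by
  suffices subY k j ≤ Subgroup.centralizer {p k (k - 1) i} from
    (Subgroup.mem_centralizer_singleton_iff.1 (this hc)).symm
  rw [subY, Subgroup.closure_le]
  rintro _ ⟨m, hm, rfl⟩
  exact Subgroup.mem_centralizer_singleton_iff.2 (commute_p_y (hij.trans hm)).symm

theorem commute_y_of_mem_subY {i j : ℕ} {c : GGrp k} (hc : c ∈ subY k j) :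
    Commute (y k (k - 1) i) c := by
  suffices subY k j ≤ Subgroup.centralizer {y k (k - 1) i} from
    (Subgroup.mem_centralizer_singleton_iff.1 (this hc)).symm
  rw [subY, Subgroup.closure_le]
  rintro _ ⟨m, hm, rfl⟩
  exact Subgroup.mem_centralizer_singleton_iff.2 (commute_y_y _ _).symm

/-- If the `p_i` are free generators of the subgroup they generate, then the subgroup generated by
the `y_i` acts faithfully on it by conjugation: an element `y_j^{n_j} y_{j+1}^{n_{j+1}} ⋯` that
centralizes `p_{j+1}` has `n_j = 0`, since `p_j^{n_j}` then commutes with `p_{j+1}`. -/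
theorem eq_one_of_mem_subY (hinj : Function.Injective (liftP k)) {j : ℕ} (hj : 1 ≤ j)
    {c : GGrp k} (hc : c ∈ subY k j) (hcp : ∀ i, Commute (p k (k - 1) i) c) : c = 1 := by
  obtain ⟨e, he⟩ : ∃ e, k ≤ j + e := ⟨k, by omega⟩
  induction e generalizing j c with
  | zero =>
    suffices subY k j ≤ ⊥ by simpa using this hc
    rw [subY, Subgroup.closure_le]
    rintro _ ⟨m, hm, rfl⟩
    exact y_eq_one (by omega)
  | succ e ih =>
    by_cases hjk : k ≤ j + e
    · exact ih hj hc hcp hjk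
    have hle : subY k j ≤ subY k (j + 1) ⊔ Subgroup.zpowers (y k (k - 1) j) := by
      rw [subY, Subgroup.closure_le]
      rintro _ ⟨m, hm, rfl⟩
      rcases hm.eq_or_lt with rfl | hm
      · exact le_sup_right (a := subY k (j + 1)) (Subgroup.mem_zpowers _)
      · exact le_sup_left (a := subY k (j + 1)) (Subgroup.subset_closure ⟨m, hm, rfl⟩)
    obtain ⟨c', hc', n, rfl⟩ :=
      mem_sup_zpowers_of_commute (fun s hs => commute_y_of_mem_subY hs) (hle hc)
    set P := p k (k - 1) with hP
    set Y := y k (k - 1) with hY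
    have h1 : Commute (P (j + 1)) (Y j ^ n) := by
      simpa using (commute_of_mem_subY le_rfl hc').inv_right.mul_right (hcp (j + 1))
    have h2 : Commute (P (j + 1)) (Y j * P j) := by
      have h : Commute (P (j + 1)) (Y j * P j * (P (j + 1))⁻¹) :=
        commute_p_mul hj (by omega) (Nat.lt_succ_self j)
      simpa using h.mul_right (Commute.refl (P (j + 1)))
    have h3 : Commute (P j) (Y j) := commute_p_y le_rfl
    have h4 : Commute (P (j + 1)) (P j ^ n) := by
      have := h1.inv_right.mul_right (h2.zpow_right n)
      rwa [h3.symm.mul_zpow, inv_mul_cancel_left] at this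
    have h5 : Commute (FreeGroup.of (⟨j - 1, by omega⟩ : Fin k) ^ n)
        (FreeGroup.of ⟨j, by omega⟩) := by
      apply hinj
      simp only [map_mul, map_zpow, liftP_of, Nat.sub_add_cancel hj]
      exact h4.symm.eq
    have hn : n = 0 := FreeGroup.eq_zero_of_commute_of (by simp; omega) h5
    subst hn
    rw [zpow_zero, mul_one] at hcp ⊢
    exact ih (by omega) hc' hcp (by omega)

end PG

/-! ### Injectivity and transfer to the pure braid group -/

namespace Braid

/-- The group `G_k` embeds in the pure braid group. -/
theorem injective_of_map_p_y {k : ℕ} {f : GGrp k →* P (k + 1)}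
    (fp : ∀ i, 1 ≤ i → f (PG.p k (k - 1) i) = p k i)
    (fy : ∀ i, 1 ≤ i → f (PG.y k (k - 1) i) = y k i) : Function.Injective f := by
  have hfP : ∀ w, f (PG.liftP k w) = FreeGroup.lift (fun i : Fin k => p k (i + 1)) w := by
    intro w
    have : f.comp (PG.liftP k) = FreeGroup.lift (fun i : Fin k => p k (i + 1)) := by
      ext i : 1
      simp [PG.liftP, fp]
    exact DFunLike.congr_fun this w
  have hfix : ∀ c ∈ PG.subY k 1,
      artin (k + 1) (f c) (FreeGroup.of (k + 1)) = FreeGroup.of (k + 1) := by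
    suffices PG.subY k 1 ≤ (MulAction.stabilizer (MulAut (FreeGroup ℕ))
        (FreeGroup.of (k + 1))).comap (((artin (k + 1)).comp (P (k + 1)).subtype).comp f) from
      fun c hc => this hc
    rw [PG.subY, Subgroup.closure_le]
    rintro _ ⟨i, hi, rfl⟩
    change artin (k + 1) (f (PG.y k (k - 1) i)) (FreeGroup.of (k + 1)) = FreeGroup.of (k + 1)
    rw [fy i hi]
    by_cases hik : i ≤ k
    · exact artin_y_last hi hik
    · rw [y_eq_one (by omega)]; simp
  -- The action on `z_{k+1}` recovers the word in the `p_i` from its product with a word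
  -- in the `y_i`.
  have hw : ∀ w, ∀ c ∈ PG.subY k 1, f (PG.liftP k w * c) = 1 → w = 1 := by
    intro w c hc h
    obtain ⟨v, hv, rfl⟩ := exists_artin_lift_p w
    have h1 := congrArg (fun b : P (k + 1) => artin (k + 1) b (FreeGroup.of (k + 1))) h
    simp only [map_mul, Subgroup.coe_mul, MulAut.mul_apply, hfix c hc, hfP, hv,
      Subgroup.coe_one, map_one, MulAut.one_apply] at h1
    refine toLetters_eq_one_of_commute ?_
    rw [mul_assoc, inv_mul_eq_iff_eq_mul] at h1
    exact h1.symm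
  have hinj : Function.Injective (PG.liftP k) := by
    rw [injective_iff_map_eq_one]
    intro w h
    exact hw w 1 (one_mem _) (by rw [h, mul_one, map_one])
  rw [injective_iff_map_eq_one]
  intro g hg
  obtain ⟨w, c, hc, rfl⟩ := PG.exists_liftP_mul g
  obtain rfl := hw w c hc hg
  rw [map_one, one_mul] at hg ⊢
  refine PG.eq_one_of_mem_subY hinj le_rfl hc fun i => ?_
  -- The commutator of `c` with `p_i` is a word in the `p_i` that lies in the kernel of `f`.
  have hN := PG.normal_range_liftP k
  have hpi := PG.p_mem_range_liftP (k := k) i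
  obtain ⟨u, hu⟩ : c * PG.p k (k - 1) i * c⁻¹ * (PG.p k (k - 1) i)⁻¹ ∈ (PG.liftP k).range :=
    mul_mem (hN.conj_mem _ hpi c) (inv_mem hpi)
  have hu1 : u = 1 := by
    refine hw u 1 (one_mem _) ?_
    rw [mul_one, hu]
    simp [hg]
  rw [hu1, map_one, eq_comm, mul_inv_eq_one, mul_inv_eq_iff_eq_mul] at hu
  exact hu.symm

end Braid

theorem mainTheorem2 (k : ℕ) (hk : 1 ≤ k) :
    -- (1) inside the presented group `K_k`
    (subL (Γ := KGrp k) (PG.x (k - 1) (k - 1)) (PG.p (k - 1) (k - 1)) (PG.y (k - 1) (k - 1)) k ⊓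
      subA (Γ := KGrp k) (PG.x (k - 1) (k - 1)) (PG.p (k - 1) (k - 1)) (PG.y (k - 1) (k - 1)) k
        = ⊥) ∧
    -- (1), (2), (3) inside the presented group `G_k`
    ((subL (Γ := GGrp k) (PG.x k (k - 1)) (PG.p k (k - 1)) (PG.y k (k - 1)) k ⊓
      subA (Γ := GGrp k) (PG.x k (k - 1)) (PG.p k (k - 1)) (PG.y k (k - 1)) k = ⊥) ∧
     Nonempty (subH (Γ := GGrp k) (PG.x k (k - 1)) (PG.y k (k - 1)) k ≃* FreeGroup (Fin k)) ∧
     subH (Γ := GGrp k) (PG.x k (k - 1)) (PG.y k (k - 1)) k ⊓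
      (subA (Γ := GGrp k) (PG.x k (k - 1)) (PG.p k (k - 1)) (PG.y k (k - 1)) k ⊔
        Subgroup.zpowers (PG.p k (k - 1) k)) = Subgroup.zpowers (PG.p k (k - 1) k)) ∧
    -- (1), (2), (3) inside the pure braid group `P_{k+1}`
    ((subL (Γ := Braid.P (k + 1)) (Braid.x k) (Braid.p k) (Braid.y k) k ⊓
      subA (Γ := Braid.P (k + 1)) (Braid.x k) (Braid.p k) (Braid.y k) k = ⊥) ∧
     Nonempty (subH (Γ := Braid.P (k + 1)) (Braid.x k) (Braid.y k) k ≃* FreeGroup (Fin k)) ∧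
     subH (Γ := Braid.P (k + 1)) (Braid.x k) (Braid.y k) k ⊓
      (subA (Γ := Braid.P (k + 1)) (Braid.x k) (Braid.p k) (Braid.y k) k ⊔
        Subgroup.zpowers (Braid.p k k)) = Subgroup.zpowers (Braid.p k k)) := by
  obtain ⟨m, rfl⟩ : ∃ m, k = m + 1 := ⟨k - 1, by omega⟩
  have hK := PG.freeDisjoint_K m
  obtain ⟨hG2, hG1⟩ := PG.freeInterCyclic_and_freeDisjoint m hK
  obtain ⟨f, fp, fy⟩ : ∃ f : PG.Grp (m + 1) m →* Braid.P (m + 1 + 1),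
      (∀ i, 1 ≤ i → f (PG.p (m + 1) m i) = Braid.p (m + 1) i) ∧
      (∀ i, 1 ≤ i → f (PG.y (m + 1) m i) = Braid.y (m + 1) i) := Braid.exists_hom (m + 1)
  have hinj : Function.Injective f := Braid.injective_of_map_p_y fp fy
  have fx : ∀ i, 1 ≤ i → i ≤ m + 1 → f (PG.x (m + 1) m i) = Braid.x (m + 1) i := by
    intro i hi him
    rw [PG.x, map_mul, map_inv, fp i hi, fp _ (by omega), Braid.p_eq_x_mul him,
      mul_inv_cancel_right]
  have hfA : f ∘ famA (PG.x (m + 1) m) (PG.p (m + 1) m) (PG.y (m + 1) m) m =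
      famA (Braid.x (m + 1)) (Braid.p (m + 1)) (Braid.y (m + 1)) m := by
    funext i
    simp only [Function.comp, famA, map_mul, apply_ite f]
    rw [fx _ (by omega) (by omega), fp _ (by omega), fy _ (by omega)]
  have hfL : f ∘ famL (PG.x (m + 1) m) (PG.p (m + 1) m) (PG.y (m + 1) m) m =
      famL (Braid.x (m + 1)) (Braid.p (m + 1)) (Braid.y (m + 1)) m := by
    funext i
    simp only [Function.comp, famL, map_mul, apply_ite f]
    rw [fx _ (by omega) (by omega), fp _ (by omega), fy _ (by omega)]
  have hfH : f ∘ famH (PG.x (m + 1) m) (PG.y (m + 1) m) (m + 1) =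
      famH (Braid.x (m + 1)) (Braid.y (m + 1)) (m + 1) := by
    funext i
    simp only [Function.comp, famH, map_mul]
    rw [fx _ (by omega) (by omega), fy _ (by omega)]
  have hP1 := hG1.comp hinj
  have hP2 := hG2.comp hinj
  rw [hfA, hfL] at hP1
  rw [hfA, hfH, fp _ (by omega)] at hP2
  have hpG := PG.p_mem_closure_famH m
  have hpP := Subgroup.mem_map_of_mem f hpG
  rw [← closure_range_comp, hfH, fp _ (by omega)] at hpP
  exact ⟨hK.subL_inf_subA,
    ⟨hG1.subL_inf_subA, hG2.nonempty_subH_equiv, hG2.subH_inf hpG⟩,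
    ⟨hP1.subL_inf_subA, hP2.nonempty_subH_equiv, hP2.subH_inf hpP⟩⟩
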